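/- Let $n\ge 0$ be an integer, $\Theta\in\mathbb R$, $\alpha\in(0,\pi/2)$, $c=\cos\alpha$, $s=\sin\alpha$, and let $B_r(0)$ be the open ball of radius $r$ about $0$ in Euclidean $\mathbb R^n$. For a set $\Omega\subset\mathbb R^n$ and $\theta\in\mathbb R$, a function $w$ is called a *viscosity subsolution* of $\sum_{i=1}^n\arctan\lambda_i(D^2w)=\theta$ on $\Omega$ if $w$ is continuous on $\Omega$ and, whenever $x_0\in\Omega$ and $Q(x)=b+p\cdot x+\frac12x^{T}Ax$ is a quadratic function ($b\in\mathbb R$, $p\in\mathbb R^n$, $A$ a real symmetric $n\times n$ matrix) with $Q(x_0)=w(x_0)$ and $Q\ge w$ on the intersection of $\Omega$ with a neighbourhood of $x_0$, one has $\sum_{i=1}^n\arctan\lambda_i(A)\ge\theta$, where $\lambda_1(A),\dots,\lambda_n(A)$ are the eigenvalues of $A$. Let $u$ be a real-valued convex function on $B_{1.2}(0)$ that is a viscosity subsolution of the special Lagrangian equation $$\sum_{i=1}^n\arctan\lambda_i(D^2u)=\Theta\quad\text{on } B_{1.2}(0).$$ Put $\tilde u(x)=s\,u(x)+\frac c2|x|^2$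 on $B_{1.2}(0)$ and $$\bar\Omega=\partial\tilde u(B_1(0))=\bigcup_{a\in B_1(0)}\partial\tilde u(a),\qquad \partial\tilde u(a)=\{p\in\mathbb R^n:\ \tilde u(x)\ge\tilde u(a)+p\cdot(x-a)\ \text{ for all }x\in B_{1.2}(0)\}.$$ Then: 1. $\bar\Omega$ is open and connected (in particular nonempty). 2. For every $\bar x\in\bar\Omega$ the supremum $\tilde u^*(\bar x)=\sup_{x\in B_1(0)}\left[\bar x\cdot x-\tilde u(x)\right]$ (the Legendre transform) is finite, so the $\alpha$-rotation $$\bar u(\bar x)=\frac12\,\frac cs\,|\bar x|^2-\frac1s\,\tilde u^*(\bar x)$$ of $u$ is well defined on $\bar\Omega$. 3. $\bar u$ is a viscosity subsolution on $\bar\Omega$ of the rotated equation $$\sum_{i=1}^n\arctan\bar\lambda_i(D^2\bar u)=\Theta-n\alpha .$$ -/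

import Mathlib

/-- A quadratic function `b + p · x + ½ xᵀ A x` on `ℝⁿ`; its Hessian is `A` when `A` is symmetric. -/
noncomputable def quadraticFn {n : ℕ} (A : Matrix (Fin n) (Fin n) ℝ)
    (p : EuclideanSpace ℝ (Fin n)) (b : ℝ) (x : EuclideanSpace ℝ (Fin n)) : ℝ :=
  b + inner ℝ p x + (1 / 2) * (x.ofLp ⬝ᵥ (A.mulVec x.ofLp))

/-- The Lagrangian phase `∑ᵢ arctan λᵢ(A)`, with `λᵢ(A)` the eigenvalues of the symmetric
matrix `A` counted with multiplicity. -/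
noncomputable def lagrangianPhase {n : ℕ} {A : Matrix (Fin n) (Fin n) ℝ}
    (hA : A.IsHermitian) : ℝ :=
  ∑ i, Real.arctan (hA.eigenvalues i)

/-- `u` is a (continuous) viscosity subsolution of `∑ᵢ arctan λᵢ(D²u) = Θ` on `Ω`: whenever a
quadratic function touches `u` from above locally at a point of `Ω`, its Hessian has
phase at least `Θ`. -/
def IsViscositySubsolution {n : ℕ} (Θ : ℝ) (Ω : Set (EuclideanSpace ℝ (Fin n)))
    (u : EuclideanSpace ℝ (Fin n) → ℝ) : Prop :=
  ContinuousOn u Ω ∧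
    ∀ x₀ ∈ Ω, ∀ (A : Matrix (Fin n) (Fin n) ℝ) (hA : A.IsHermitian)
      (p : EuclideanSpace ℝ (Fin n)) (b : ℝ),
      quadraticFn A p b x₀ = u x₀ →
      (∀ᶠ x in nhdsWithin x₀ Ω, u x ≤ quadraticFn A p b x) →
      Θ ≤ lagrangianPhase hA

/-- The subdifferential at `a` of a function `f` on the domain `D`: the gradients of the affine
functions that support `f` from below on `D` at `a`. -/
def subdifferential {n : ℕ} (D : Set (EuclideanSpace ℝ (Fin n)))
    (f : EuclideanSpace ℝ (Fin n) → ℝ) (a : EuclideanSpace ℝ (Fin n)) :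
    Set (EuclideanSpace ℝ (Fin n)) :=
  {p | ∀ x ∈ D, f a + inner ℝ p (x - a) ≤ f x}

/-- The values `y · x - f x`, `|x| < 1`, whose supremum is the Legendre transform of `f` at `y`. -/
def legendreValues {n : ℕ} (f : EuclideanSpace ℝ (Fin n) → ℝ)
    (y : EuclideanSpace ℝ (Fin n)) : Set ℝ :=
  (fun x => inner ℝ y x - f x) '' Metric.ball (0 : EuclideanSpace ℝ (Fin n)) 1

/-- The Legendre transform `f*(y) = sup_{|x| < 1} (y · x - f x)`. -/
noncomputable def legendre {n : ℕ} (f : EuclideanSpace ℝ (Fin n) → ℝ)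
    (y : EuclideanSpace ℝ (Fin n)) : ℝ :=
  sSup (legendreValues f y)

/-- `ũ(x) = s u(x) + (c/2)|x|²` with `(c, s) = (cos α, sin α)`. -/
noncomputable def tildePotential {n : ℕ} (α : ℝ) (u : EuclideanSpace ℝ (Fin n) → ℝ)
    (x : EuclideanSpace ℝ (Fin n)) : ℝ :=
  Real.sin α * u x + Real.cos α / 2 * ‖x‖ ^ 2

/-- The `α`-rotation `ū(y) = (c/2s)|y|² - (1/s) ũ*(y)` with `(c, s) = (cos α, sin α)`. -/
noncomputable def alphaRotation {n : ℕ} (α : ℝ) (u : EuclideanSpace ℝ (Fin n) → ℝ)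
    (y : EuclideanSpace ℝ (Fin n)) : ℝ :=
  1 / 2 * (Real.cos α / Real.sin α) * ‖y‖ ^ 2
    - 1 / Real.sin α * legendre (tildePotential α u) y

/-- `Ω̄ = ∂ũ(B₁(0))`, for `u` given on `B_{1.2}(0)`. -/
def rotatedDomain {n : ℕ} (α : ℝ) (u : EuclideanSpace ℝ (Fin n) → ℝ) :
    Set (EuclideanSpace ℝ (Fin n)) :=
  ⋃ a ∈ Metric.ball (0 : EuclideanSpace ℝ (Fin n)) 1,
    subdifferential (Metric.ball 0 1.2) (tildePotential α u) a

/-! Write f for ũ, c = cos α and s = sin α. Convexity of u makes f strongly convex with modulus c,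
so the subgradient relation has an inverse `dualPoint`, which is single-valued and 1/c-Lipschitz on
Ω̄. Openness holds because f minus a slightly tilted linear function still has its minimum near a
given point (`StrongConvexOn.exists_mem_subdifferential`). For connectedness, `dualPoint` is a
quotient map from Ω̄ onto the connected unit ball, and its fibres are subdifferentials, hence
convex. The suprema are finite because f is bounded below on the unit ball.

For the viscosity inequality, Legendre duality inverts Hessians. If D²u has eigenvalue λ, then D²f
has eigenvalue ν = sλ + c, D²f* has 1/ν, and the rotated Hessian has (c - 1/ν)/s, whose arctangent
is arctan λ - α (`arctan_rotation`). The difficulty is that u need not be twice differentiable at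
the contact point. The remedy is to replace u by its averages V over small balls.

By Alexandrov's theorem (`ae_exists_hasSpecExpansion`), almost every point carries a second order
expansion of u, and the subsolution property then bounds the phase of its Hessian below by Θ. The
phase is concave on positive semidefinite matrices, so averaging Hessians preserves this bound. The
rest of the second order behaviour of u has a favourable sign by convexity. Hence V has at every
point a quadratic lower bound of phase at least Θ - τ, for any τ > 0
(`exists_specForm_le_meanTranslate`).

A quadratic touching ū from above becomes a function R touching f* from below, made strict by a
small quadratic penalty. Strict contact survives the passage from f to g = sV + (c/2)|x|², at nearby
points a₁, y₁ (`exists_contact`). There the quadratic lower bound for g dualizes to an upper bound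
on the Hessian of R. Weyl monotonicity and the rotation identity give the claim up to an error that
tends to 0. -/

/-! ### Quadratic forms, Weyl monotonicity and concavity of the phase. -/

section LinearAlgebra

open Matrix

variable {n : ℕ}

/-- The quadratic form `xᵀ A x`. -/
def quadForm (A : Matrix (Fin n) (Fin n) ℝ) (x : EuclideanSpace ℝ (Fin n)) : ℝ :=
  x.ofLp ⬝ᵥ (A.mulVec x.ofLp)

/-- The quadratic form which is diagonal in the orthonormal basis `b`, with eigenvalues `w`. -/
noncomputable def specForm (b : OrthonormalBasis (Fin n) ℝ (EuclideanSpace ℝ (Fin n)))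
    (w : Fin n → ℝ) (x : EuclideanSpace ℝ (Fin n)) : ℝ :=
  ∑ i, w i * (inner ℝ (b i) x) ^ 2

/-- The matrix of `specForm b w`. -/
noncomputable def specMatrix (b : OrthonormalBasis (Fin n) ℝ (EuclideanSpace ℝ (Fin n)))
    (w : Fin n → ℝ) : Matrix (Fin n) (Fin n) ℝ :=
  Matrix.of fun k l => ∑ i, w i * ((b i).ofLp k * (b i).ofLp l)

lemma inner_eq_sum_mul (x y : EuclideanSpace ℝ (Fin n)) :
    inner ℝ x y = ∑ i, x.ofLp i * y.ofLp i := by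
  simp [PiLp.inner_apply, mul_comm]

lemma quadForm_eq_sum (A : Matrix (Fin n) (Fin n) ℝ) (x : EuclideanSpace ℝ (Fin n)) :
    quadForm A x = ∑ k, ∑ l, A k l * (x.ofLp k * x.ofLp l) := by
  simp only [quadForm, dotProduct, mulVec, Finset.mul_sum]
  exact Finset.sum_congr rfl fun k _ => Finset.sum_congr rfl fun l _ => by ring

lemma specMatrix_isHermitian (b : OrthonormalBasis (Fin n) ℝ (EuclideanSpace ℝ (Fin n)))
    (w : Fin n → ℝ) : (specMatrix b w).IsHermitian := by
  ext k l
  simp [specMatrix, mul_comm]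

lemma quadForm_specMatrix (b : OrthonormalBasis (Fin n) ℝ (EuclideanSpace ℝ (Fin n)))
    (w : Fin n → ℝ) (x : EuclideanSpace ℝ (Fin n)) :
    quadForm (specMatrix b w) x = specForm b w x := by
  simp only [quadForm_eq_sum, specForm, specMatrix, Matrix.of_apply, inner_eq_sum_mul, sq,
    Finset.mul_sum, Finset.sum_mul]
  rw [Finset.sum_congr rfl fun k _ => Finset.sum_comm, Finset.sum_comm]
  refine Finset.sum_congr rfl fun i _ => Finset.sum_congr rfl fun k _ =>
    Finset.sum_congr rfl fun l _ => by ring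

lemma quadForm_eq_inner (A : Matrix (Fin n) (Fin n) ℝ) (x : EuclideanSpace ℝ (Fin n)) :
    quadForm A x = inner ℝ x (WithLp.toLp 2 (A.mulVec x.ofLp)) := by
  simp [inner_eq_sum_mul, quadForm, dotProduct]

lemma inner_mulVec_comm {A : Matrix (Fin n) (Fin n) ℝ} (hA : A.IsHermitian)
    (x y : EuclideanSpace ℝ (Fin n)) :
    inner ℝ x (WithLp.toLp 2 (A.mulVec y.ofLp)) =
      inner ℝ (WithLp.toLp 2 (A.mulVec x.ofLp)) y := by
  have hT : Aᵀ = A := by simpa [Matrix.IsHermitian] using hA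
  have h1 : inner ℝ x (WithLp.toLp 2 (A.mulVec y.ofLp)) = x.ofLp ⬝ᵥ (A.mulVec y.ofLp) := by
    simp [inner_eq_sum_mul, dotProduct]
  have h2 : inner ℝ (WithLp.toLp 2 (A.mulVec x.ofLp)) y = (A.mulVec x.ofLp) ⬝ᵥ y.ofLp := by
    simp [inner_eq_sum_mul, dotProduct]
  rw [h1, h2, dotProduct_mulVec, ← mulVec_transpose, hT]

lemma quadForm_eq_specForm {A : Matrix (Fin n) (Fin n) ℝ} (hA : A.IsHermitian)
    (x : EuclideanSpace ℝ (Fin n)) :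
    quadForm A x = specForm hA.eigenvectorBasis hA.eigenvalues x := by
  rw [quadForm_eq_inner, ← hA.eigenvectorBasis.sum_inner_mul_inner, specForm]
  refine Finset.sum_congr rfl fun i _ => ?_
  rw [inner_mulVec_comm hA, hA.mulVec_eigenvectorBasis, WithLp.toLp_smul, WithLp.toLp_ofLp,
    real_inner_smul_left, real_inner_comm]
  ring

lemma specForm_basis (b : OrthonormalBasis (Fin n) ℝ (EuclideanSpace ℝ (Fin n)))
    (w : Fin n → ℝ) (i : Fin n) : specForm b w (b i) = w i := by
  simp [specForm, b.inner_eq_ite]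

lemma specForm_const (b : OrthonormalBasis (Fin n) ℝ (EuclideanSpace ℝ (Fin n)))
    (t : ℝ) (x : EuclideanSpace ℝ (Fin n)) : specForm b (fun _ => t) x = t * ‖x‖ ^ 2 := by
  rw [specForm, ← Finset.mul_sum, ← b.sum_sq_inner_right x]

lemma specForm_add (b : OrthonormalBasis (Fin n) ℝ (EuclideanSpace ℝ (Fin n)))
    (v w : Fin n → ℝ) (x : EuclideanSpace ℝ (Fin n)) :
    specForm b (fun i => v i + w i) x = specForm b v x + specForm b w x := by
  simp [specForm, add_mul, Finset.sum_add_distrib]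

lemma specForm_const_mul (b : OrthonormalBasis (Fin n) ℝ (EuclideanSpace ℝ (Fin n)))
    (t : ℝ) (w : Fin n → ℝ) (x : EuclideanSpace ℝ (Fin n)) :
    specForm b (fun i => t * w i) x = t * specForm b w x := by
  simp [specForm, Finset.mul_sum, mul_assoc]

lemma specForm_mono (b : OrthonormalBasis (Fin n) ℝ (EuclideanSpace ℝ (Fin n)))
    {v w : Fin n → ℝ} (h : ∀ i, v i ≤ w i) (x : EuclideanSpace ℝ (Fin n)) :
    specForm b v x ≤ specForm b w x :=
  Finset.sum_le_sum fun i _ => mul_le_mul_of_nonneg_right (h i) (sq_nonneg _)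

lemma specForm_smul (b : OrthonormalBasis (Fin n) ℝ (EuclideanSpace ℝ (Fin n)))
    (w : Fin n → ℝ) (t : ℝ) (x : EuclideanSpace ℝ (Fin n)) :
    specForm b w (t • x) = t ^ 2 * specForm b w x := by
  simp only [specForm, real_inner_smul_right, Finset.mul_sum]
  exact Finset.sum_congr rfl fun i _ => by ring

lemma quadForm_smul (A : Matrix (Fin n) (Fin n) ℝ) (t : ℝ) (x : EuclideanSpace ℝ (Fin n)) :
    quadForm A (t • x) = t ^ 2 * quadForm A x := by
  simp only [quadForm_eq_sum, Finset.mul_sum]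
  exact Finset.sum_congr rfl fun i _ => Finset.sum_congr rfl fun j _ => by
    simp only [PiLp.smul_apply, smul_eq_mul]; ring

/-- Weyl's monotonicity principle, for sums of a monotone function of the eigenvalues. -/
lemma sum_le_sum_of_specForm_le (b e : OrthonormalBasis (Fin n) ℝ (EuclideanSpace ℝ (Fin n)))
    {v w : Fin n → ℝ} (h : ∀ x, specForm b v x ≤ specForm e w x) {φ : ℝ → ℝ}
    (hφ : Monotone φ) : ∑ i, φ (v i) ≤ ∑ i, φ (w i) := by
  classical
  -- Hall's condition for the relation `v i ≤ w j`. A perfect matching replaces the ordering of the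
  -- eigenvalues. If it failed for S, a dimension count would give a nonzero vector on which the
  -- form of `v` is at least `v i₀ * ‖x‖ ^ 2` and that of `w` is strictly less.
  have hall : ∀ S : Finset (Fin n),
      S.card ≤ (S.biUnion fun i => Finset.univ.filter fun j => v i ≤ w j).card := by
    intro S
    rcases S.eq_empty_or_nonempty with rfl | hS
    · simp
    obtain ⟨i₀, hi₀, hmin⟩ := S.exists_min_image v hS
    have hsub : (Finset.univ.filter fun j => v i₀ ≤ w j) ⊆
        S.biUnion fun i => Finset.univ.filter fun j => v i ≤ w j :=
      Finset.subset_biUnion_of_mem (fun i => Finset.univ.filter fun j => v i ≤ w j) hi₀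
    refine le_trans ?_ (Finset.card_le_card hsub)
    set J := Finset.univ.filter fun j => v i₀ ≤ w j with hJ
    by_contra hlt
    push Not at hlt
    -- a nonzero vector in the span of `b i`, `i ∈ S`, orthogonal to `e j`, `j ∈ J`
    let L : (S → ℝ) →ₗ[ℝ] (J → ℝ) :=
      LinearMap.pi fun j => ∑ i : S, (inner ℝ (e j) (b i)) • LinearMap.proj i
    have hker : LinearMap.ker L ≠ ⊥ := by
      apply LinearMap.ker_ne_bot_of_finrank_lt
      simpa using hlt
    obtain ⟨t, htL, ht0⟩ := (Submodule.ne_bot_iff _).1 hker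
    set x : EuclideanSpace ℝ (Fin n) := ∑ i : S, t i • b i with hx
    have hxe : ∀ j ∈ J, inner ℝ (e j) x = 0 := by
      intro j hj
      have := congrFun (LinearMap.mem_ker.1 htL) ⟨j, hj⟩
      simp only [L, LinearMap.pi_apply, LinearMap.sum_apply, LinearMap.smul_apply,
        LinearMap.proj_apply, smul_eq_mul, Pi.zero_apply] at this
      rw [hx, inner_sum, ← this]
      exact Finset.sum_congr rfl fun i _ => by rw [real_inner_smul_right, mul_comm]
    have hxb : ∀ i ∉ S, inner ℝ (b i) x = 0 := by
      intro i hi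
      rw [hx, inner_sum]
      refine Finset.sum_eq_zero fun k _ => ?_
      rw [real_inner_smul_right, b.inner_eq_ite, if_neg, mul_zero]
      rintro rfl
      exact hi k.2
    have hxb' : ∀ i : S, inner ℝ (b i) x = t i := by
      intro i
      rw [hx, inner_sum, Finset.sum_eq_single i]
      · simp [real_inner_smul_right]
      · intro k _ hk
        rw [real_inner_smul_right, b.inner_eq_ite, if_neg, mul_zero]
        exact fun hh => hk (Subtype.ext hh.symm)
      · simp
    have hx0 : x ≠ 0 := by
      intro h0
      apply ht0
      funext i
      rw [← hxb' i, h0, inner_zero_right]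
      rfl
    have h1 : v i₀ * ‖x‖ ^ 2 ≤ specForm b v x := by
      rw [← specForm_const b]
      refine Finset.sum_le_sum fun i _ => ?_
      by_cases hi : i ∈ S
      · exact mul_le_mul_of_nonneg_right (hmin i hi) (sq_nonneg _)
      · simp [hxb i hi]
    have h2 : specForm e w x < v i₀ * ‖x‖ ^ 2 := by
      rw [← specForm_const e]
      have hle : ∀ j, w j * (inner ℝ (e j) x) ^ 2 ≤ v i₀ * (inner ℝ (e j) x) ^ 2 := by
        intro j
        by_cases hj : j ∈ J
        · simp [hxe j hj]
        · have : w j < v i₀ := by simpa [hJ] using hj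
          exact mul_le_mul_of_nonneg_right this.le (sq_nonneg _)
      obtain ⟨j, hj⟩ : ∃ j, inner ℝ (e j) x ≠ 0 := by
        by_contra hcon
        push Not at hcon
        apply hx0
        rw [← e.sum_repr' x]
        simp [hcon]
      refine Finset.sum_lt_sum (fun j _ => hle j) ⟨j, Finset.mem_univ _, ?_⟩
      have hjJ : j ∉ J := fun hjJ => hj (hxe j hjJ)
      have : w j < v i₀ := by simpa [hJ] using hjJ
      exact mul_lt_mul_of_pos_right this (by positivity)
    exact absurd (h x) (by linarith)
  obtain ⟨σ, hσ, hσ'⟩ := (Finset.all_card_le_biUnion_card_iff_exists_injective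
    (fun i => Finset.univ.filter fun j => v i ≤ w j)).1 hall
  have hb : Function.Bijective σ := Finite.injective_iff_bijective.1 hσ
  calc ∑ i, φ (v i) ≤ ∑ i, φ (w (σ i)) := by
        refine Finset.sum_le_sum fun i _ => hφ ?_
        simpa using hσ' i
    _ = ∑ i, φ (w i) := hb.sum_comp fun i => φ (w i)

lemma lagrangianPhase_le_of_quadForm_le {A : Matrix (Fin n) (Fin n) ℝ} (hA : A.IsHermitian)
    (b : OrthonormalBasis (Fin n) ℝ (EuclideanSpace ℝ (Fin n))) {w : Fin n → ℝ}
    (h : ∀ x, quadForm A x ≤ specForm b w x) :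
    lagrangianPhase hA ≤ ∑ i, Real.arctan (w i) :=
  sum_le_sum_of_specForm_le hA.eigenvectorBasis b
    (fun x => by rw [← quadForm_eq_specForm hA]; exact h x) Real.arctan_mono

lemma arctan_add_le (x : ℝ) {t : ℝ} (ht : 0 ≤ t) :
    Real.arctan (x + t) ≤ Real.arctan x + t := by
  have h := (convex_univ : Convex ℝ (Set.univ : Set ℝ)).image_sub_le_mul_sub_of_deriv_le
    (f := Real.arctan) (C := 1) Real.continuous_arctan.continuousOn
    Real.differentiable_arctan.differentiableOn (fun y _ => by
      rw [Real.deriv_arctan, div_le_one (by positivity)]; nlinarith [sq_nonneg y])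
    x trivial (x + t) trivial (by linarith)
  linarith

lemma concaveOn_arctan : ConcaveOn ℝ (Set.Ici 0) Real.arctan := by
  refine AntitoneOn.concaveOn_of_deriv (convex_Ici 0) Real.continuous_arctan.continuousOn
    Real.differentiable_arctan.differentiableOn ?_
  intro x hx y hy hxy
  rw [interior_Ici] at hx hy
  rw [Real.deriv_arctan]
  change 1 / (1 + y ^ 2) ≤ 1 / (1 + x ^ 2)
  have : 0 < x := hx
  exact one_div_le_one_div_of_le (by positivity) (by gcongr)

/-- Peierls' inequality for the Lagrangian phase of a positive semidefinite matrix. -/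
lemma lagrangianPhase_le_sum_arctan_quadForm {A : Matrix (Fin n) (Fin n) ℝ}
    (hA : A.IsHermitian) (hpos : ∀ x, 0 ≤ quadForm A x)
    (b : OrthonormalBasis (Fin n) ℝ (EuclideanSpace ℝ (Fin n))) :
    lagrangianPhase hA ≤ ∑ i, Real.arctan (quadForm A (b i)) := by
  set e := hA.eigenvectorBasis
  have hev : ∀ j, 0 ≤ hA.eigenvalues j := fun j => by
    have := hpos (e j)
    rwa [quadForm_eq_specForm hA, specForm_basis] at this
  -- The squared inner products form a doubly stochastic matrix: its rows give Jensen weights here,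
  -- and its columns sum to 1 when the inequalities are added.
  have key : ∀ i, ∑ j, (inner ℝ (e j) (b i)) ^ 2 * Real.arctan (hA.eigenvalues j) ≤
      Real.arctan (quadForm A (b i)) := by
    intro i
    have := concaveOn_arctan.le_map_sum (t := Finset.univ)
      (w := fun j => (inner ℝ (e j) (b i) : ℝ) ^ 2) (p := hA.eigenvalues)
      (fun j _ => sq_nonneg _) (by rw [e.sum_sq_inner_right]; simp) (fun j _ => hev j)
    simp only [smul_eq_mul] at this
    refine this.trans (le_of_eq ?_)
    rw [quadForm_eq_specForm hA, specForm]
    congr 1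
    exact Finset.sum_congr rfl fun j _ => mul_comm _ _
  refine le_trans ?_ (Finset.sum_le_sum fun i _ => key i)
  rw [Finset.sum_comm, lagrangianPhase]
  refine Finset.sum_le_sum fun j _ => ?_
  rw [← Finset.sum_mul, b.sum_sq_inner_left]
  simp

end LinearAlgebra

/-! ### Subgradients, conjugates and strong convexity. -/

section ConvexAnalysis

open Set Metric Filter Topology

variable {n : ℕ}

/-- A convex function on an open convex set has a subgradient at every point. -/
lemma exists_subgradient {S : Set (EuclideanSpace ℝ (Fin n))}
    {f : EuclideanSpace ℝ (Fin n) → ℝ} (hS : IsOpen S) (hf : ConvexOn ℝ S f)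
    {a : EuclideanSpace ℝ (Fin n)} (ha : a ∈ S) : (subdifferential S f a).Nonempty := by
  have hcont : ContinuousOn f S := hf.continuousOn hS
  set U : Set (EuclideanSpace ℝ (Fin n) × ℝ) := {p | p.1 ∈ S ∧ f p.1 < p.2} with hU
  have hUc : Convex ℝ U := hf.convex_strict_epigraph
  have hUo : IsOpen U := by
    have h1 : ContinuousOn (fun p : EuclideanSpace ℝ (Fin n) × ℝ => p.2 - f p.1)
        (Prod.fst ⁻¹' S) :=
      continuous_snd.continuousOn.sub (hcont.comp continuous_fst.continuousOn fun _ h => h)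
    have := h1.isOpen_inter_preimage (hS.preimage continuous_fst) (isOpen_Ioi (a := (0 : ℝ)))
    convert this using 1
    ext p
    simp [hU]
  obtain ⟨φ, hφ⟩ := geometric_hahn_banach_open_point hUc hUo (x := (a, f a)) (by simp [hU])
  have hsplit : ∀ x t, φ (x, t) = φ (x, 0) + t * φ (0, 1) := by
    intro x t
    have : (x, t) = (x, (0 : ℝ)) + t • ((0 : EuclideanSpace ℝ (Fin n)), (1 : ℝ)) := by simp
    rw [this, map_add, map_smul, smul_eq_mul]
  set β := φ (0, 1) with hβ
  -- The separating hyperplane is not vertical, since the strict epigraph contains a point directly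
  -- above `(a, f a)`.
  have hβ0 : β < 0 := by
    have := hφ (a, f a + 1) (by simp [hU, ha])
    rw [hsplit a, hsplit a (f a)] at this
    nlinarith
  have hle : ∀ x ∈ S, φ (x, 0) + f x * β ≤ φ (a, 0) + f a * β := by
    intro x hx
    -- Graph points are only limits of the strict epigraph; raising the height by `ε / (-β)` costs
    -- exactly ε in the functional.
    refine le_of_forall_pos_le_add fun ε hε => ?_
    have := hφ (x, f x + ε / (-β)) (by exact ⟨hx, by
      have : 0 < ε / (-β) := div_pos hε (by linarith)
      change f x < f x + ε / (-β)
      linarith⟩)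
    rw [hsplit x, hsplit a] at this
    have h2 : ε / (-β) * β = -ε := by
      have := hβ0.ne
      field_simp
    nlinarith
  set ψ : EuclideanSpace ℝ (Fin n) →L[ℝ] ℝ := φ.comp (ContinuousLinearMap.inl ℝ _ ℝ) with hψ
  refine ⟨(InnerProductSpace.toDual ℝ _).symm ((-β⁻¹) • ψ), fun x hx => ?_⟩
  rw [InnerProductSpace.toDual_symm_apply]
  have h3 := hle x hx
  have h4 : ψ (x - a) = φ (x, 0) - φ (a, 0) := by
    rw [map_sub]; rfl
  rw [smul_apply, h4, smul_eq_mul]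
  have h5 : (-β⁻¹) * (φ (x, 0) - φ (a, 0)) ≤ (-β⁻¹) * ((f a - f x) * β) := by
    apply mul_le_mul_of_nonneg_left
    · linarith
    · have := inv_lt_zero.2 hβ0
      linarith
  have h6 : (-β⁻¹) * ((f a - f x) * β) = f x - f a := by
    have := hβ0.ne
    field_simp
    ring
  linarith

/-- A local lower bound by a nondegenerate quadratic for a convex function gives the dual upper
bound for the affine functions that it dominates. -/
lemma inner_sub_le_of_specForm_le {S : Set (EuclideanSpace ℝ (Fin n))}
    {F : EuclideanSpace ℝ (Fin n) → ℝ} (hF : ConvexOn ℝ S F)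
    {x₀ p : EuclideanSpace ℝ (Fin n)} (hx₀ : x₀ ∈ S)
    (b : OrthonormalBasis (Fin n) ℝ (EuclideanSpace ℝ (Fin n))) {ν : Fin n → ℝ} {κ r : ℝ}
    (hκ : 0 < κ) (hν : ∀ i, κ ≤ ν i) (hr : 0 < r)
    (hlow : ∀ h, ‖h‖ ≤ r → x₀ + h ∈ S →
      F x₀ + inner ℝ p h + 1 / 2 * specForm b ν h ≤ F (x₀ + h))
    {k : EuclideanSpace ℝ (Fin n)} (hk : ‖k‖ ≤ κ * r / 2)
    {x : EuclideanSpace ℝ (Fin n)} (hx : x ∈ S) :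
    inner ℝ (p + k) x - F x ≤
      inner ℝ p x₀ - F x₀ + inner ℝ k x₀ + 1 / 2 * specForm b (fun i => (ν i)⁻¹) k := by
  obtain ⟨h, rfl⟩ : ∃ h, x = x₀ + h := ⟨x - x₀, by abel⟩
  rw [inner_add_left, inner_add_right, inner_add_right]
  suffices inner ℝ p h + inner ℝ k h - F (x₀ + h) ≤
      - F x₀ + 1 / 2 * specForm b (fun i => (ν i)⁻¹) k by linarith
  by_cases hh : ‖h‖ ≤ r
  · have h1 := hlow h hh hx
    have h2 : inner ℝ k h ≤
        1 / 2 * specForm b ν h + 1 / 2 * specForm b (fun i => (ν i)⁻¹) k := by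
      rw [← b.sum_inner_mul_inner k h, specForm, specForm, Finset.mul_sum, Finset.mul_sum,
        ← Finset.sum_add_distrib]
      refine Finset.sum_le_sum fun i _ => ?_
      have hpos : 0 < ν i := hκ.trans_le (hν i)
      rw [real_inner_comm]
      set s : ℝ := inner ℝ (b i) k
      set t : ℝ := inner ℝ (b i) h
      have h3 : 0 ≤ (ν i)⁻¹ * (ν i * t - s) ^ 2 := by positivity
      have h4 : (ν i)⁻¹ * (ν i * t - s) ^ 2 = ν i * t ^ 2 - 2 * s * t + (ν i)⁻¹ * s ^ 2 := by
        field_simp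
        ring
      linarith
    linarith
  -- Outside radius r, convexity along the segment from `x₀` propagates the bound at radius r: F
  -- exceeds its affine part by at least `κ * r / 2 * ‖h‖`, which absorbs `k`.
  · push Not at hh
    have hh0 : 0 < ‖h‖ := hr.trans hh
    set t := r / ‖h‖ with ht
    have ht0 : 0 < t := div_pos hr hh0
    have ht1 : t ≤ 1 := (div_le_one hh0).2 hh.le
    have hth : t * ‖h‖ = r := div_mul_cancel₀ _ hh0.ne'
    have heq : (1 - t) • x₀ + t • (x₀ + h) = x₀ + t • h := by
      rw [sub_smul, one_smul, smul_add]; abel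
    have hmem : x₀ + t • h ∈ S := by
      rw [← heq]
      exact hF.1 hx₀ hx (by linarith) ht0.le (by ring)
    have h1 := hF.2 hx₀ hx (by linarith : 0 ≤ 1 - t) ht0.le (by ring)
    rw [heq, smul_eq_mul, smul_eq_mul] at h1
    have h2 := hlow (t • h) (by rw [norm_smul, Real.norm_of_nonneg ht0.le, hth]) hmem
    have h3 : κ * r ^ 2 ≤ specForm b ν (t • h) := by
      have := specForm_mono b (v := fun _ => κ) hν (t • h)
      rwa [specForm_const, norm_smul, Real.norm_of_nonneg ht0.le, hth] at this
    rw [real_inner_smul_right] at h2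
    have h4 : t * (F x₀ + inner ℝ p h + 1 / 2 * (κ * r * ‖h‖)) ≤ t * F (x₀ + h) := by
      have : t * (κ * r * ‖h‖) = κ * r ^ 2 := by
        rw [← hth]; ring
      linarith
    have h5 := le_of_mul_le_mul_left h4 ht0
    have h6 : inner ℝ k h ≤ ‖k‖ * ‖h‖ := real_inner_le_norm _ _
    have h7 : ‖k‖ * ‖h‖ ≤ κ * r / 2 * ‖h‖ := by gcongr
    have h8 : 0 ≤ specForm b (fun i => (ν i)⁻¹) k :=
      Finset.sum_nonneg fun i _ => mul_nonneg
        (inv_nonneg.2 (hκ.le.trans (hν i))) (sq_nonneg _)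
    linarith

/-- The convex conjugate of `F` restricted to `X`. -/
noncomputable def conjOn (X : Set (EuclideanSpace ℝ (Fin n)))
    (F : EuclideanSpace ℝ (Fin n) → ℝ) (y : EuclideanSpace ℝ (Fin n)) : ℝ :=
  sSup ((fun x => inner ℝ y x - F x) '' X)

lemma bddAbove_inner_sub {X : Set (EuclideanSpace ℝ (Fin n))}
    {F : EuclideanSpace ℝ (Fin n) → ℝ} (hX : X ⊆ closedBall 0 1) (hF : BddBelow (F '' X))
    (y : EuclideanSpace ℝ (Fin n)) : BddAbove ((fun x => inner ℝ y x - F x) '' X) := by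
  obtain ⟨m, hm⟩ := hF
  refine ⟨‖y‖ - m, ?_⟩
  rintro _ ⟨x, hx, rfl⟩
  have h1 : m ≤ F x := hm (mem_image_of_mem _ hx)
  have h2 : inner ℝ y x ≤ ‖y‖ * ‖x‖ := real_inner_le_norm _ _
  have h3 : ‖x‖ ≤ 1 := by simpa using hX hx
  have h4 : ‖y‖ * ‖x‖ ≤ ‖y‖ := mul_le_of_le_one_right (norm_nonneg _) h3
  change inner ℝ y x - F x ≤ ‖y‖ - m
  linarith

section conjOn

variable {X : Set (EuclideanSpace ℝ (Fin n))} {F : EuclideanSpace ℝ (Fin n) → ℝ}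
  (hX : X ⊆ closedBall 0 1) (hF : BddBelow (F '' X))
include hX hF

lemma le_conjOn {x : EuclideanSpace ℝ (Fin n)} (hx : x ∈ X) (y : EuclideanSpace ℝ (Fin n)) :
    inner ℝ y x - F x ≤ conjOn X F y :=
  le_csSup (bddAbove_inner_sub hX hF y) ⟨x, hx, rfl⟩

end conjOn

lemma conjOn_le {X : Set (EuclideanSpace ℝ (Fin n))} {F : EuclideanSpace ℝ (Fin n) → ℝ}
    (hne : X.Nonempty) {y : EuclideanSpace ℝ (Fin n)} {M : ℝ}
    (h : ∀ x ∈ X, inner ℝ y x - F x ≤ M) : conjOn X F y ≤ M := by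
  apply csSup_le (hne.image _)
  rintro _ ⟨x, hx, rfl⟩
  exact h x hx

lemma lipschitzWith_conjOn {X : Set (EuclideanSpace ℝ (Fin n))}
    {F : EuclideanSpace ℝ (Fin n) → ℝ} (hX : X ⊆ closedBall 0 1) (hF : BddBelow (F '' X))
    (hne : X.Nonempty) : LipschitzWith 1 (conjOn X F) := by
  apply LipschitzWith.of_le_add
  intro y z
  apply conjOn_le hne
  intro x hx
  have h1 := le_conjOn hX hF hx z
  have h2 : inner ℝ (y - z) x ≤ ‖y - z‖ * ‖x‖ := real_inner_le_norm _ _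
  have h3 : ‖x‖ ≤ 1 := by simpa using hX hx
  have h4 : ‖y - z‖ * ‖x‖ ≤ ‖y - z‖ := mul_le_of_le_one_right (norm_nonneg _) h3
  rw [inner_sub_left] at h2
  rw [dist_eq_norm]
  linarith

lemma convexOn_conjOn {X : Set (EuclideanSpace ℝ (Fin n))}
    {F : EuclideanSpace ℝ (Fin n) → ℝ} (hX : X ⊆ closedBall 0 1) (hF : BddBelow (F '' X))
    (hne : X.Nonempty) : ConvexOn ℝ univ (conjOn X F) := by
  refine ⟨convex_univ, fun y _ z _ s t hs ht hst => ?_⟩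
  apply conjOn_le hne
  intro x hx
  have h1 := mul_le_mul_of_nonneg_left (le_conjOn hX hF hx y) hs
  have h2 := mul_le_mul_of_nonneg_left (le_conjOn hX hF hx z) ht
  rw [inner_add_left, real_inner_smul_left, real_inner_smul_left, smul_eq_mul, smul_eq_mul]
  have h3 : F x = s * F x + t * F x := by rw [← add_mul, hst, one_mul]
  linarith

section StrongConvexity

variable {D : Set (EuclideanSpace ℝ (Fin n))} {f : EuclideanSpace ℝ (Fin n) → ℝ} {c : ℝ}

/-- Compare the subgradient inequality with strong convexity at the point of parameter t on the
segment from a to x, divide by t and let t tend to 0. -/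
lemma StrongConvexOn.le_of_mem_subdifferential (hf : StrongConvexOn D c f)
    {a y : EuclideanSpace ℝ (Fin n)} (ha : a ∈ D) (hy : y ∈ subdifferential D f a)
    {x : EuclideanSpace ℝ (Fin n)} (hx : x ∈ D) :
    f a + inner ℝ y (x - a) + c / 2 * ‖x - a‖ ^ 2 ≤ f x := by
  have key : ∀ t ∈ Ioo (0 : ℝ) 1,
      f a + inner ℝ y (x - a) + c / 2 * ‖x - a‖ ^ 2 * (1 - t) ≤ f x := by
    rintro t ⟨ht0, ht1⟩
    have h1 := hf.2 ha hx (by linarith : 0 ≤ 1 - t) ht0.le (by ring)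
    have heq : (1 - t) • a + t • x = a + t • (x - a) := by
      rw [sub_smul, one_smul, smul_sub]; abel
    have hmem : a + t • (x - a) ∈ D := by
      rw [← heq]; exact hf.1 ha hx (by linarith) ht0.le (by ring)
    have h2 := hy _ hmem
    rw [heq] at h1
    rw [add_sub_cancel_left, real_inner_smul_right] at h2
    simp only [smul_eq_mul] at h1
    rw [norm_sub_rev a x] at h1
    have h3 : t * (f a + inner ℝ y (x - a) + c / 2 * ‖x - a‖ ^ 2 * (1 - t)) ≤ t * f x := by
      linarith
    exact le_of_mul_le_mul_left h3 ht0
  have hlim : Tendsto (fun t : ℝ => f a + inner ℝ y (x - a) + c / 2 * ‖x - a‖ ^ 2 * (1 - t))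
      (𝓝[>] 0) (𝓝 (f a + inner ℝ y (x - a) + c / 2 * ‖x - a‖ ^ 2 * (1 - 0))) :=
    Tendsto.mono_left (Continuous.tendsto (by fun_prop) 0) nhdsWithin_le_nhds
  have := le_of_tendsto hlim (by
    filter_upwards [Ioo_mem_nhdsGT (zero_lt_one : (0 : ℝ) < 1)] with t ht using key t ht)
  simpa using this

lemma StrongConvexOn.le_inner_of_mem_subdifferential (hf : StrongConvexOn D c f)
    {a b p q : EuclideanSpace ℝ (Fin n)} (ha : a ∈ D) (hb : b ∈ D)
    (hp : p ∈ subdifferential D f a) (hq : q ∈ subdifferential D f b) :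
    c * ‖a - b‖ ^ 2 ≤ inner ℝ (p - q) (a - b) := by
  have h1 := hf.le_of_mem_subdifferential ha hp hb
  have h2 := hf.le_of_mem_subdifferential hb hq ha
  rw [norm_sub_rev] at h1
  rw [← neg_sub a b, inner_neg_right] at h1
  rw [inner_sub_left]
  linarith

lemma StrongConvexOn.norm_sub_le_of_mem_subdifferential (hf : StrongConvexOn D c f)
    {a b p q : EuclideanSpace ℝ (Fin n)} (ha : a ∈ D) (hb : b ∈ D)
    (hp : p ∈ subdifferential D f a) (hq : q ∈ subdifferential D f b) :
    c * ‖a - b‖ ≤ ‖p - q‖ := by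
  have h1 := hf.le_inner_of_mem_subdifferential ha hb hp hq
  have h2 : inner ℝ (p - q) (a - b) ≤ ‖p - q‖ * ‖a - b‖ := real_inner_le_norm _ _
  rcases (norm_nonneg (a - b)).eq_or_lt with h0 | h0
  · rw [← h0, mul_zero]; exact norm_nonneg _
  · refine le_of_mul_le_mul_right ?_ h0
    linarith [sq ‖a - b‖]

/-- The subgradients at the points near `a` of a strongly convex function fill a neighbourhood of
each subgradient at `a`. -/
lemma StrongConvexOn.exists_mem_subdifferential (hf : StrongConvexOn D c f) (hc : 0 < c)
    (hfc : ContinuousOn f D) {a y₀ : EuclideanSpace ℝ (Fin n)} {r : ℝ} (hr : 0 < r)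
    (ha : closedBall a r ⊆ D) (hy₀ : y₀ ∈ subdifferential D f a)
    {y : EuclideanSpace ℝ (Fin n)} (hy : ‖y - y₀‖ < c / 2 * r) :
    ∃ x ∈ ball a r, y ∈ subdifferential D f x := by
  have haD : a ∈ D := ha (mem_closedBall_self hr.le)
  have hcont : ContinuousOn (fun x => f x - inner ℝ y x) (closedBall a r) :=
    (hfc.mono ha).sub (by fun_prop)
  obtain ⟨x, hx, hmin⟩ := (isCompact_closedBall a r).exists_isMinOn
    (nonempty_closedBall.2 hr.le) hcont
  have hxa : f x - inner ℝ y x ≤ f a - inner ℝ y a := hmin (mem_closedBall_self hr.le)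
  -- Beyond distance r the quadratic growth of f beats the tilt by `y - y₀`, so the minimum over the
  -- closed ball is interior and global on D.
  have hout : ∀ z ∈ D, r ≤ ‖z - a‖ → f a - inner ℝ y a < f z - inner ℝ y z := by
    intro z hz hrz
    have h1 := hf.le_of_mem_subdifferential haD hy₀ hz
    have h2 : inner ℝ (y - y₀) (z - a) ≤ ‖y - y₀‖ * ‖z - a‖ := real_inner_le_norm _ _
    have h0 : 0 < ‖z - a‖ := hr.trans_le hrz
    have h3 : ‖y - y₀‖ * ‖z - a‖ < c / 2 * r * ‖z - a‖ := by gcongr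
    have h4 : c / 2 * r * ‖z - a‖ ≤ c / 2 * ‖z - a‖ ^ 2 := by
      rw [sq, ← mul_assoc]; gcongr
    rw [inner_sub_left, inner_sub_right y] at h2
    linarith
  have hxb : x ∈ ball a r := by
    rw [mem_ball, dist_eq_norm]
    by_contra hcon
    push Not at hcon
    exact absurd (hout x (ha hx) hcon) (by linarith)
  refine ⟨x, hxb, fun z hz => ?_⟩
  rw [inner_sub_right]
  by_cases hza : ‖z - a‖ ≤ r
  · have h5 : f x - inner ℝ y x ≤ f z - inner ℝ y z :=
      hmin (mem_closedBall_iff_norm.2 hza)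
    linarith
  · have := hout z hz (le_of_not_ge hza)
    linarith

end StrongConvexity

end ConvexAnalysis

/-! ### The domain Ω̄, the inverse subgradient map and the Legendre transform. -/

section DualDomain

open Set Metric Filter Topology

variable {n : ℕ} {f : EuclideanSpace ℝ (Fin n) → ℝ} {c : ℝ}

/-- The set of the subgradients of `f` at the points of the unit ball. -/
def dualDomain (f : EuclideanSpace ℝ (Fin n) → ℝ) : Set (EuclideanSpace ℝ (Fin n)) :=
  ⋃ a ∈ ball (0 : EuclideanSpace ℝ (Fin n)) 1, subdifferential (ball 0 1.2) f a

lemma mem_dualDomain {y : EuclideanSpace ℝ (Fin n)} :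
    y ∈ dualDomain f ↔
      ∃ a ∈ ball (0 : EuclideanSpace ℝ (Fin n)) 1, y ∈ subdifferential (ball 0 1.2) f a := by
  simp [dualDomain]

open Classical in
/-- The point of the unit ball where `y` is a subgradient of `f`. -/
noncomputable def dualPoint (f : EuclideanSpace ℝ (Fin n) → ℝ)
    (y : EuclideanSpace ℝ (Fin n)) : EuclideanSpace ℝ (Fin n) :=
  if h : ∃ a ∈ ball (0 : EuclideanSpace ℝ (Fin n)) 1, y ∈ subdifferential (ball 0 1.2) f a
  then h.choose else 0

lemma dualPoint_spec {y : EuclideanSpace ℝ (Fin n)} (hy : y ∈ dualDomain f) :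
    dualPoint f y ∈ ball (0 : EuclideanSpace ℝ (Fin n)) 1 ∧
      y ∈ subdifferential (ball 0 1.2) f (dualPoint f y) := by
  have h := mem_dualDomain.1 hy
  rw [dualPoint, dif_pos h]
  exact h.choose_spec

lemma closedBall_one_subset :
    closedBall (0 : EuclideanSpace ℝ (Fin n)) 1.1 ⊆ ball 0 1.2 :=
  closedBall_subset_ball (by norm_num)

lemma unitBall_subset : ball (0 : EuclideanSpace ℝ (Fin n)) 1 ⊆ ball 0 1.2 :=
  ball_subset_ball (by norm_num)

lemma exists_closedBall_subset {a : EuclideanSpace ℝ (Fin n)} (ha : a ∈ ball 0 1) :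
    ∃ r > 0, closedBall a r ⊆ ball (0 : EuclideanSpace ℝ (Fin n)) 1 :=
  nhds_basis_closedBall.mem_iff.1 (isOpen_ball.mem_nhds ha)

/-- The radius 1.1 leaves room on both sides: the closed ball is compact inside the domain, and
points of the unit ball can move by 0.1 within it. -/
lemma exists_abs_le (hfc : ContinuousOn f (ball 0 1.2)) :
    ∃ M, ∀ x ∈ closedBall (0 : EuclideanSpace ℝ (Fin n)) 1.1, |f x| ≤ M := by
  obtain ⟨M, hM⟩ := (isCompact_closedBall (0 : EuclideanSpace ℝ (Fin n)) 1.1).exists_bound_of_continuousOn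
    (hfc.mono closedBall_one_subset)
  exact ⟨M, fun x hx => by simpa using hM x hx⟩

lemma bddBelow_image_of_continuousOn (hfc : ContinuousOn f (ball 0 1.2)) :
    BddBelow (f '' ball 0 1) := by
  obtain ⟨M, hM⟩ := exists_abs_le hfc
  refine ⟨-M, ?_⟩
  rintro _ ⟨x, hx, rfl⟩
  exact neg_le_of_abs_le (hM x (ball_subset_closedBall
    (ball_subset_ball (by norm_num) hx)))

lemma le_legendre (hfc : ContinuousOn f (ball 0 1.2)) {x : EuclideanSpace ℝ (Fin n)}
    (hx : x ∈ ball 0 1) (y : EuclideanSpace ℝ (Fin n)) : inner ℝ y x - f x ≤ legendre f y :=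
  le_conjOn ball_subset_closedBall (bddBelow_image_of_continuousOn hfc) hx y

lemma lipschitzWith_legendre (hfc : ContinuousOn f (ball 0 1.2)) :
    LipschitzWith 1 (legendre f) :=
  lipschitzWith_conjOn ball_subset_closedBall (bddBelow_image_of_continuousOn hfc)
    ⟨0, by simp⟩

lemma convexOn_legendre (hfc : ContinuousOn f (ball 0 1.2)) :
    ConvexOn ℝ univ (legendre f) :=
  convexOn_conjOn ball_subset_closedBall (bddBelow_image_of_continuousOn hfc)
    ⟨0, by simp⟩

lemma legendre_eq_of_mem (hfc : ContinuousOn f (ball 0 1.2)) {a y : EuclideanSpace ℝ (Fin n)}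
    (ha : a ∈ ball 0 1) (hy : y ∈ subdifferential (ball 0 1.2) f a) :
    legendre f y = inner ℝ y a - f a := by
  refine le_antisymm ?_ (le_legendre hfc ha y)
  refine conjOn_le ⟨0, by simp⟩ fun x hx => ?_
  have := hy x (unitBall_subset hx)
  rw [inner_sub_right] at this
  linarith

lemma exists_norm_le_of_mem_dualDomain (hfc : ContinuousOn f (ball 0 1.2)) :
    ∃ R, ∀ y ∈ dualDomain f, ‖y‖ ≤ R := by
  obtain ⟨M, hM⟩ := exists_abs_le hfc
  refine ⟨20 * M, fun y hy => ?_⟩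
  obtain ⟨a, ha, hya⟩ := mem_dualDomain.1 hy
  have ha1 : ‖a‖ < 1 := by simpa using ha
  have haM := abs_le.1 (hM a (by rw [mem_closedBall_zero_iff]; norm_num; linarith))
  rcases (norm_nonneg y).eq_or_lt with h0 | h0
  · rw [← h0]; linarith
  -- Moving from a by 0.1 in the direction of y raises f by at least `0.1 * ‖y‖`, while f oscillates
  -- by at most 2M.
  have hnorm : ‖(0.1 / ‖y‖) • y‖ = 0.1 := by
    rw [norm_smul, Real.norm_of_nonneg (by positivity), div_mul_cancel₀ _ h0.ne']
  have hx : a + (0.1 / ‖y‖) • y ∈ closedBall (0 : EuclideanSpace ℝ (Fin n)) 1.1 := by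
    rw [mem_closedBall_zero_iff]
    refine (norm_add_le _ _).trans ?_
    rw [hnorm]
    norm_num
    linarith
  have h1 := hya _ (closedBall_one_subset hx)
  have h2 := abs_le.1 (hM _ hx)
  rw [add_sub_cancel_left, real_inner_smul_right, real_inner_self_eq_norm_sq] at h1
  have h3 : 0.1 / ‖y‖ * ‖y‖ ^ 2 = 0.1 * ‖y‖ := by field_simp
  norm_num at h3 h1 h2 ⊢
  linarith

section

variable (hf : StrongConvexOn (ball 0 1.2) c f) (hc : 0 < c)
include hf hc

lemma dualPoint_eq {a y : EuclideanSpace ℝ (Fin n)} (ha : a ∈ ball 0 1)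
    (hy : y ∈ subdifferential (ball 0 1.2) f a) : dualPoint f y = a := by
  have h := dualPoint_spec (mem_dualDomain.2 ⟨a, ha, hy⟩)
  have h1 := hf.norm_sub_le_of_mem_subdifferential (unitBall_subset h.1) (unitBall_subset ha)
    h.2 hy
  rw [sub_self, norm_zero] at h1
  have h2 : ‖dualPoint f y - a‖ = 0 := by
    nlinarith [norm_nonneg (dualPoint f y - a)]
  exact sub_eq_zero.1 (norm_eq_zero.1 h2)

omit hc in
lemma le_inner_dualPoint {y z : EuclideanSpace ℝ (Fin n)} (hy : y ∈ dualDomain f)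
    (hz : z ∈ dualDomain f) : c * ‖dualPoint f y - dualPoint f z‖ ^ 2 ≤
      inner ℝ (y - z) (dualPoint f y - dualPoint f z) := by
  have h := dualPoint_spec hy
  have h' := dualPoint_spec hz
  exact hf.le_inner_of_mem_subdifferential (unitBall_subset h.1) (unitBall_subset h'.1) h.2 h'.2

lemma lipschitzOnWith_dualPoint :
    LipschitzOnWith (Real.toNNReal c⁻¹) (dualPoint f) (dualDomain f) := by
  refine LipschitzOnWith.of_dist_le_mul fun y hy z hz => ?_
  have h := dualPoint_spec hy
  have h' := dualPoint_spec hz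
  have h1 := hf.norm_sub_le_of_mem_subdifferential (unitBall_subset h.1)
    (unitBall_subset h'.1) h.2 h'.2
  rw [dist_eq_norm, dist_eq_norm, Real.coe_toNNReal _ (inv_nonneg.2 hc.le)]
  rw [inv_mul_eq_div, le_div_iff₀ hc]
  linarith

variable (hfc : ContinuousOn f (ball 0 1.2))
include hfc

lemma isOpen_dualDomain : IsOpen (dualDomain f) := by
  rw [Metric.isOpen_iff]
  intro y₀ hy₀
  obtain ⟨a, ha, hya⟩ := mem_dualDomain.1 hy₀
  obtain ⟨r, hr, hball⟩ := exists_closedBall_subset ha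
  refine ⟨c / 2 * r, by positivity, fun y hy => ?_⟩
  obtain ⟨x, hx, hyx⟩ := hf.exists_mem_subdifferential hc hfc hr
    (hball.trans unitBall_subset) hya (mem_ball_iff_norm.1 hy)
  exact mem_dualDomain.2 ⟨x, hball (ball_subset_closedBall hx), hyx⟩

omit hf hc in
lemma mem_subdifferential_of_tendsto {x : ℕ → EuclideanSpace ℝ (Fin n)}
    {p : ℕ → EuclideanSpace ℝ (Fin n)} {a q : EuclideanSpace ℝ (Fin n)} (ha : a ∈ ball 0 1.2)
    (hx : Tendsto x atTop (𝓝 a)) (hp : Tendsto p atTop (𝓝 q))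
    (h : ∀ k, p k ∈ subdifferential (ball 0 1.2) f (x k)) :
    q ∈ subdifferential (ball 0 1.2) f a := by
  intro z hz
  have hfx : Tendsto (fun k => f (x k)) atTop (𝓝 (f a)) :=
    (hfc.continuousAt (isOpen_ball.mem_nhds ha)).tendsto.comp hx
  have hlim : Tendsto (fun k => f (x k) + inner ℝ (p k) (z - x k)) atTop
      (𝓝 (f a + inner ℝ q (z - a))) :=
    hfx.add (hp.inner (tendsto_const_nhds.sub hx))
  exact le_of_tendsto hlim (Eventually.of_forall fun k => h k z hz)

/-- Connectedness lifts through a quotient map with connected fibres. Here the base is the unit ball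
and the fibres are the convex sets of subgradients. -/
lemma isConnected_dualDomain : IsConnected (dualDomain f) := by
  have hconv : ConvexOn ℝ (ball 0 1.2) f := by
    have := hf.strictConvexOn hc
    exact this.convexOn
  have hsub : ∀ a ∈ ball (0 : EuclideanSpace ℝ (Fin n)) 1,
      (subdifferential (ball 0 1.2) f a).Nonempty := fun a ha =>
    exists_subgradient isOpen_ball hconv (unitBall_subset ha)
  let G : dualDomain f → ball (0 : EuclideanSpace ℝ (Fin n)) 1 :=
    fun y => ⟨dualPoint f y, (dualPoint_spec y.2).1⟩
  have hGc : Continuous G := by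
    refine Continuous.subtype_mk ?_ _
    exact continuousOn_iff_continuous_domRestrict.1 (lipschitzOnWith_dualPoint hf hc).continuousOn
  have hfib : ∀ a, IsConnected (G ⁻¹' {a}) := by
    intro a
    have hset : (Subtype.val '' (G ⁻¹' {a})) = subdifferential (ball 0 1.2) f a.1 := by
      ext y
      constructor
      · rintro ⟨z, hz, rfl⟩
        have hz' : G z = a := hz
        rw [← hz']
        exact (dualPoint_spec z.2).2
      · intro hy
        exact ⟨⟨y, mem_dualDomain.2 ⟨a, a.2, hy⟩⟩, Subtype.ext (dualPoint_eq hf hc a.2 hy), rfl⟩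
    have hcvx : Convex ℝ (subdifferential (ball 0 1.2) f a.1) := by
      intro p hp q hq s t hs ht hst x hx
      have h1 := mul_le_mul_of_nonneg_left (hp x hx) hs
      have h2 := mul_le_mul_of_nonneg_left (hq x hx) ht
      rw [inner_add_left, real_inner_smul_left, real_inner_smul_left]
      have h3 : s * f x + t * f x = f x := by rw [← add_mul, hst, one_mul]
      have h4 : s * f a + t * f a = f a := by rw [← add_mul, hst, one_mul]
      linarith
    have hpre : IsPreconnected (Subtype.val '' (G ⁻¹' {a})) := by
      rw [hset]; exact hcvx.isPreconnected
    obtain ⟨y, hy⟩ := hsub a a.2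
    rw [← hset] at hy
    obtain ⟨z, hz, -⟩ := hy
    exact ⟨⟨z, hz⟩, Topology.IsInducing.subtypeVal.isPreconnected_image.1 hpre⟩
  -- Closedness descends by compactness: along a convergent sequence of base points the subgradients
  -- stay bounded, and any cluster point is a subgradient at the limit.
  have hco : IsCoinducing G := by
    rw [isCoinducing_iff_isClosed]
    refine fun T => ⟨fun hT => ?_, fun hT => hT.preimage hGc⟩
    refine IsSeqClosed.isClosed fun x a hx hxa => ?_
    choose p hp using fun k => hsub (x k) (x k).2
    have hpΩ : ∀ k, p k ∈ dualDomain f := fun k => mem_dualDomain.2 ⟨x k, (x k).2, hp k⟩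
    obtain ⟨R, hR⟩ := exists_norm_le_of_mem_dualDomain hfc
    obtain ⟨q, -, φ, hφ, hlim⟩ := (isCompact_closedBall (0 : EuclideanSpace ℝ (Fin n)) R).tendsto_subseq
      (x := p) (fun k => by simpa using hR _ (hpΩ k))
    have hxa' : Tendsto (fun k => ((x k : ball (0 : EuclideanSpace ℝ (Fin n)) 1) :
        EuclideanSpace ℝ (Fin n))) atTop (𝓝 a) := (continuous_subtype_val.tendsto a).comp hxa
    have hq : q ∈ subdifferential (ball 0 1.2) f a :=
      mem_subdifferential_of_tendsto hfc (unitBall_subset a.2)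
        (hxa'.comp hφ.tendsto_atTop) hlim fun k => hp (φ k)
    have hqΩ : q ∈ dualDomain f := mem_dualDomain.2 ⟨a, a.2, hq⟩
    have hmem : (⟨q, hqΩ⟩ : dualDomain f) ∈ G ⁻¹' T := by
      refine hT.mem_of_tendsto (f := fun k => (⟨p (φ k), hpΩ _⟩ : dualDomain f)) (b := atTop)
        (tendsto_subtype_rng.2 hlim) (Eventually.of_forall fun k => ?_)
      have : G ⟨p (φ k), hpΩ _⟩ = x (φ k) :=
        Subtype.ext (dualPoint_eq hf hc (x (φ k)).2 (hp _))
      rw [mem_preimage, this]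
      exact hx _
    have : G ⟨q, hqΩ⟩ = a := Subtype.ext (dualPoint_eq hf hc a.2 hq)
    rwa [mem_preimage, this] at hmem
  have hconn : IsConnected (univ : Set (ball (0 : EuclideanSpace ℝ (Fin n)) 1)) := by
    have : IsConnected (ball (0 : EuclideanSpace ℝ (Fin n)) 1) :=
      ⟨⟨0, by simp⟩, (convex_ball _ _).isPreconnected⟩
    have := isConnected_iff_connectedSpace.1 this
    exact isConnected_univ
  have := hco.isConnected_preimage_of_isClosed hfib isClosed_univ hconn
  rw [preimage_univ] at this
  have := this.image _ continuous_subtype_val.continuousOn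
  rwa [image_univ, Subtype.range_coe] at this

/-- Dual points are subgradients of the Legendre transform. The inequalities at y and at y + h
squeeze the first order remainder between 0 and the pairing of h with the change of dual point,
which is at most `c⁻¹ * ‖h‖ ^ 2`. -/
lemma hasFDerivAt_legendre {y : EuclideanSpace ℝ (Fin n)} (hy : y ∈ dualDomain f) :
    HasFDerivAt (legendre f) (innerSL ℝ (dualPoint f y)) y := by
  have hle : ∀ z ∈ dualDomain f, ∀ w,
      legendre f z + inner ℝ (dualPoint f z) (w - z) ≤ legendre f w := by
    intro z hz w
    have h := dualPoint_spec hz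
    have h1 := le_legendre hfc h.1 w
    rw [legendre_eq_of_mem hfc h.1 h.2, inner_sub_right, real_inner_comm w, real_inner_comm z]
    linarith
  rw [hasFDerivAt_iff_isLittleO_nhds_zero]
  refine Asymptotics.IsBigO.trans_isLittleO (g := fun h => ‖h‖ ^ 2) ?_
    (Asymptotics.isLittleO_norm_pow_id one_lt_two)
  refine Asymptotics.IsBigO.of_bound c⁻¹ ?_
  have hnhds : ∀ᶠ h in 𝓝 (0 : EuclideanSpace ℝ (Fin n)), y + h ∈ dualDomain f := by
    have : Tendsto (fun h => y + h) (𝓝 0) (𝓝 (y + 0)) := by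
      exact (continuous_const.add continuous_id).tendsto 0
    rw [add_zero] at this
    exact this.eventually_mem ((isOpen_dualDomain hf hc hfc).mem_nhds hy)
  filter_upwards [hnhds] with h hh
  have h1 := hle y hy (y + h)
  have h2 := hle _ hh y
  rw [add_sub_cancel_left] at h1
  rw [sub_add_cancel_left, inner_neg_right] at h2
  have h3 := (lipschitzOnWith_dualPoint hf hc).dist_le_mul _ hh _ hy
  rw [dist_eq_norm, dist_eq_norm, Real.coe_toNNReal _ (inv_nonneg.2 hc.le),
    add_sub_cancel_left] at h3
  have h4 : inner ℝ (dualPoint f (y + h) - dualPoint f y) h ≤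
      ‖dualPoint f (y + h) - dualPoint f y‖ * ‖h‖ := real_inner_le_norm _ _
  have h5 : ‖dualPoint f (y + h) - dualPoint f y‖ * ‖h‖ ≤ c⁻¹ * ‖h‖ * ‖h‖ := by gcongr
  rw [inner_sub_left] at h4
  rw [innerSL_apply_apply, Real.norm_of_nonneg (by linarith), norm_pow, norm_norm]
  nlinarith

end

end DualDomain

/-! ### Alexandrov's theorem through the Lipschitz inverse gradient. -/

section Alexandrov

open Set Metric Filter Topology MeasureTheory

variable {n : ℕ}

/-- `v` has at `x` the second order expansion with gradient `p` and with the Hessian that is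
diagonal in the orthonormal basis `b` with eigenvalues `w`. -/
def HasSpecExpansion (v : EuclideanSpace ℝ (Fin n) → ℝ) (x p : EuclideanSpace ℝ (Fin n))
    (b : OrthonormalBasis (Fin n) ℝ (EuclideanSpace ℝ (Fin n))) (w : Fin n → ℝ) : Prop :=
  ∀ η > 0, ∀ᶠ h in 𝓝 (0 : EuclideanSpace ℝ (Fin n)),
    |v (x + h) - v x - inner ℝ p h - 1 / 2 * specForm b w h| ≤ η * ‖h‖ ^ 2

lemma isSymmetric_of_hasFDerivAt_gradient {F : EuclideanSpace ℝ (Fin n) → ℝ}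
    {g : EuclideanSpace ℝ (Fin n) → EuclideanSpace ℝ (Fin n)} {y : EuclideanSpace ℝ (Fin n)}
    {T : EuclideanSpace ℝ (Fin n) →L[ℝ] EuclideanSpace ℝ (Fin n)}
    (hF : ∀ᶠ z in 𝓝 y, HasFDerivAt F (innerSL ℝ (g z)) z) (hg : HasFDerivAt g T y) :
    T.toLinearMap.IsSymmetric := by
  let J : EuclideanSpace ℝ (Fin n) →L[ℝ] EuclideanSpace ℝ (Fin n) →L[ℝ] ℝ := innerSL ℝ
  have h1 : HasFDerivAt (fun z => J (g z)) (J.comp T) y := J.hasFDerivAt.comp y hg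
  intro v w
  have h2 := second_derivative_symmetric_of_eventually hF h1 v w
  have h3 : inner ℝ (T v) w = inner ℝ (T w) v := h2
  change inner ℝ (T v) w = inner ℝ v (T w)
  rw [h3, real_inner_comm]

/-- Second order Taylor expansion at a point where the gradient is differentiable. -/
lemma eventually_abs_sub_le_of_hasFDerivAt_gradient {F : EuclideanSpace ℝ (Fin n) → ℝ}
    {g : EuclideanSpace ℝ (Fin n) → EuclideanSpace ℝ (Fin n)} {y : EuclideanSpace ℝ (Fin n)}
    {T : EuclideanSpace ℝ (Fin n) →L[ℝ] EuclideanSpace ℝ (Fin n)}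
    (hF : ∀ᶠ z in 𝓝 y, HasFDerivAt F (innerSL ℝ (g z)) z) (hg : HasFDerivAt g T y)
    {η : ℝ} (hη : 0 < η) :
    ∀ᶠ k in 𝓝 (0 : EuclideanSpace ℝ (Fin n)),
      |F (y + k) - F y - inner ℝ (g y) k - 1 / 2 * inner ℝ (T k) k| ≤ η * ‖k‖ ^ 2 := by
  have hsym := isSymmetric_of_hasFDerivAt_gradient hF hg
  have hshift : Tendsto (fun k => y + k) (𝓝 0) (𝓝 y) := by
    have : Continuous fun k => y + k := by fun_prop
    exact this.tendsto' 0 y (by simp)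
  have h1 := hshift.eventually hF
  have h2 := (hasFDerivAt_iff_isLittleO_nhds_zero.1 hg).def hη
  obtain ⟨δ, hδ, hball⟩ := Metric.eventually_nhds_iff_ball.1 (h1.and h2)
  refine Metric.eventually_nhds_iff_ball.2 ⟨δ, hδ, fun k hk => ?_⟩
  -- By symmetry of T the gradient of this remainder at z is `g (y + z) - g y - T z`, of norm at
  -- most `η * ‖k‖`; the mean value inequality gains the second factor `‖k‖`.
  set φ : EuclideanSpace ℝ (Fin n) → ℝ :=
    fun k => F (y + k) - inner ℝ (g y) k - 1 / 2 * inner ℝ (T k) k with hφ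
  have hk' : ‖k‖ < δ := by simpa using hk
  have hmem : ∀ z ∈ closedBall (0 : EuclideanSpace ℝ (Fin n)) ‖k‖, z ∈ ball 0 δ := fun z hz => by
    rw [mem_closedBall_zero_iff] at hz
    rw [mem_ball_zero_iff]
    linarith
  have hderiv : ∀ z ∈ closedBall (0 : EuclideanSpace ℝ (Fin n)) ‖k‖,
      HasFDerivWithinAt φ (innerSL ℝ (g (y + z) - g y - T z)) (closedBall 0 ‖k‖) z := by
    intro z hz
    apply HasFDerivAt.hasFDerivWithinAt
    have hd1 : HasFDerivAt (fun k => F (y + k)) (innerSL ℝ (g (y + z))) z :=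
      (hball z (hmem z hz)).1.comp z ((hasFDerivAt_id z).const_add y)
    have hd2 : HasFDerivAt (fun k => inner ℝ (g y) k) (innerSL ℝ (g y)) z :=
      (innerSL ℝ (g y)).hasFDerivAt
    have hd3 := (T.hasFDerivAt (x := z)).inner ℝ (hasFDerivAt_id z)
    refine ((hd1.sub hd2).sub (hd3.const_mul (1 / 2))).congr_fderiv ?_
    ext w
    have hs : inner ℝ (T w) z = inner ℝ w (T z) := hsym w z
    simp [fderivInnerCLM_apply, hs, real_inner_comm]
    ring
  have hbound : ∀ z ∈ closedBall (0 : EuclideanSpace ℝ (Fin n)) ‖k‖,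
      ‖innerSL ℝ (g (y + z) - g y - T z)‖ ≤ η * ‖k‖ := by
    intro z hz
    rw [innerSL_apply_norm]
    refine (hball z (hmem z hz)).2.trans ?_
    have := mem_closedBall_zero_iff.1 hz
    gcongr
  have := (convex_closedBall (0 : EuclideanSpace ℝ (Fin n)) ‖k‖).norm_image_sub_le_of_norm_hasFDerivWithin_le
    hderiv hbound (x := 0) (y := k) (by simp) (by simp)
  rw [Real.norm_eq_abs, sub_zero] at this
  calc _ = |φ k - φ 0| := by simp only [hφ]; congr 1; simp; ring
    _ ≤ _ := by rw [sq, ← mul_assoc]; exact this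

lemma exists_pos_le_of_pos {τ : Fin n → ℝ} (hτ : ∀ i, 0 < τ i) : ∃ κ > 0, ∀ i, κ ≤ τ i := by
  have hS : 0 ≤ ∑ i, (τ i)⁻¹ := Finset.sum_nonneg fun i _ => (inv_pos.2 (hτ i)).le
  refine ⟨(1 + ∑ i, (τ i)⁻¹)⁻¹, by positivity, fun i => ?_⟩
  have := Finset.single_le_sum (f := fun i => (τ i)⁻¹) (fun i _ => (inv_pos.2 (hτ i)).le)
    (Finset.mem_univ i)
  rw [inv_le_comm₀ (by positivity) (hτ i)]
  change (τ i)⁻¹ ≤ _ at this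
  linarith

/-- A strongly monotone symmetric invertible operator is diagonal in an orthonormal basis. -/
lemma exists_basis_of_isSymmetric {c : ℝ} (hc : 0 < c)
    {T : EuclideanSpace ℝ (Fin n) →L[ℝ] EuclideanSpace ℝ (Fin n)}
    (hT : T.toLinearMap.IsSymmetric) (hdet : T.det ≠ 0)
    (hmono : ∀ k, c * ‖T k‖ ^ 2 ≤ inner ℝ (T k) k) :
    ∃ (b : OrthonormalBasis (Fin n) ℝ (EuclideanSpace ℝ (Fin n))) (τ : Fin n → ℝ),
      (∀ i, 0 < τ i) ∧ (∀ i, c ≤ (τ i)⁻¹) ∧ ∀ k, inner ℝ (T k) k = specForm b τ k := by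
  set b := hT.eigenvectorBasis finrank_euclideanSpace_fin with hb
  set τ := hT.eigenvalues finrank_euclideanSpace_fin with hτ
  have hTb : ∀ i, T (b i) = τ i • b i := fun i =>
    hT.apply_eigenvectorBasis finrank_euclideanSpace_fin i
  have hnorm : ∀ i, ‖b i‖ = 1 := fun i => b.orthonormal.1 i
  -- Monotonicity tested on an eigenvector: it makes the eigenvalue nonnegative and, once nonzero,
  -- at most `c⁻¹`.
  have h1 : ∀ i, c * τ i ^ 2 ≤ τ i := by
    intro i
    have := hmono (b i)
    rwa [hTb, norm_smul, hnorm, mul_one, Real.norm_eq_abs, sq_abs, real_inner_smul_left,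
      real_inner_self_eq_norm_sq, hnorm, one_pow, mul_one] at this
  have h2 : ∀ i, τ i ≠ 0 := by
    intro i h0
    have hz : T (b i) = 0 := by rw [hTb, h0, zero_smul]
    have hinj : Function.Injective T.toLinearMap := by
      exact (LinearMap.equivOfDetNeZero T.toLinearMap hdet).injective
    have : b i = 0 := hinj (by simpa using hz)
    have h3 := hnorm i
    rw [this, norm_zero] at h3
    exact zero_ne_one h3
  have h3 : ∀ i, 0 < τ i := fun i =>
    lt_of_le_of_ne ((mul_nonneg hc.le (sq_nonneg _)).trans (h1 i)) (h2 i).symm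
  refine ⟨b, τ, h3, fun i => ?_, fun k => ?_⟩
  · rw [le_inv_comm₀ hc (h3 i), ← one_div, le_div_iff₀ hc]
    have := h1 i
    rw [sq, ← mul_assoc] at this
    have := le_of_mul_le_mul_right (by linarith : c * τ i * τ i ≤ 1 * τ i) (h3 i)
    linarith
  · rw [← b.sum_inner_mul_inner, specForm]
    refine Finset.sum_congr rfl fun i _ => ?_
    have : inner ℝ (T k) (b i) = inner ℝ k (T (b i)) := hT k (b i)
    rw [this, hTb, real_inner_smul_right, real_inner_comm k]
    ring

variable {f : EuclideanSpace ℝ (Fin n) → ℝ} {c : ℝ}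

/-- The infinitesimal form of strong monotonicity, as a limit of difference quotients. -/
lemma le_inner_fderiv_dualPoint (hf : StrongConvexOn (ball 0 1.2) c f) (hc : 0 < c)
    (hfc : ContinuousOn f (ball 0 1.2)) {y : EuclideanSpace ℝ (Fin n)} (hy : y ∈ dualDomain f)
    {T : EuclideanSpace ℝ (Fin n) →L[ℝ] EuclideanSpace ℝ (Fin n)}
    (hT : HasFDerivAt (dualPoint f) T y) (k : EuclideanSpace ℝ (Fin n)) :
    c * ‖T k‖ ^ 2 ≤ inner ℝ (T k) k := by
  have hlim : Tendsto (fun t : ℝ => t⁻¹ • (dualPoint f (y + t • k) - dualPoint f y)) (𝓝[≠] 0)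
      (𝓝 (T k)) := by
    have := (hT.hasLineDerivAt k).tendsto_slope_zero
    simpa using this
  have hmem : ∀ᶠ t : ℝ in 𝓝[≠] 0, y + t • k ∈ dualDomain f := by
    have h1 : Tendsto (fun t : ℝ => y + t • k) (𝓝 0) (𝓝 y) := by
      have : Continuous fun t : ℝ => y + t • k := by fun_prop
      simpa using this.tendsto 0
    exact (h1.mono_left nhdsWithin_le_nhds).eventually_mem
      ((isOpen_dualDomain hf hc hfc).mem_nhds hy)
  refine le_of_tendsto_of_tendsto ((hlim.norm.pow 2).const_mul c)
    (hlim.inner tendsto_const_nhds) ?_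
  filter_upwards [hmem, self_mem_nhdsWithin] with t ht ht0
  have ht0' : t ≠ 0 := ht0
  have h1 := le_inner_dualPoint hf ht hy
  rw [add_sub_cancel_left, real_inner_smul_left, real_inner_comm] at h1
  rw [norm_smul, mul_pow, real_inner_smul_left, norm_inv, Real.norm_eq_abs, inv_pow, sq_abs]
  have h2 := mul_le_mul_of_nonneg_left h1 (by positivity : 0 ≤ (t ^ 2)⁻¹)
  have h3 : (t ^ 2)⁻¹ * (t * inner ℝ (dualPoint f (y + t • k) - dualPoint f y) k) =
      t⁻¹ * inner ℝ (dualPoint f (y + t • k) - dualPoint f y) k := by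
    field_simp
  rw [h3] at h2
  linarith

/-- The linear map which is diagonal in `b` with eigenvalues `w`. -/
noncomputable def specMap (b : OrthonormalBasis (Fin n) ℝ (EuclideanSpace ℝ (Fin n)))
    (w : Fin n → ℝ) : EuclideanSpace ℝ (Fin n) →L[ℝ] EuclideanSpace ℝ (Fin n) :=
  ∑ i, w i • (innerSL ℝ (b i)).smulRight (b i)

lemma inner_basis_specMap (b : OrthonormalBasis (Fin n) ℝ (EuclideanSpace ℝ (Fin n)))
    (w : Fin n → ℝ) (h : EuclideanSpace ℝ (Fin n)) (i : Fin n) :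
    inner ℝ (b i) (specMap b w h) = w i * inner ℝ (b i) h := by
  classical
  simp only [specMap, FunLike.coe_sum, Finset.sum_apply, smul_apply,
    ContinuousLinearMap.smulRight_apply, innerSL_apply_apply, inner_sum, real_inner_smul_right,
    b.inner_eq_ite]
  simp

lemma inner_specMap (b : OrthonormalBasis (Fin n) ℝ (EuclideanSpace ℝ (Fin n)))
    (w : Fin n → ℝ) (h : EuclideanSpace ℝ (Fin n)) :
    inner ℝ (specMap b w h) h = specForm b w h := by
  rw [← b.sum_inner_mul_inner, specForm]
  refine Finset.sum_congr rfl fun i _ => ?_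
  rw [real_inner_comm, inner_basis_specMap]
  ring

/-- At a point of invertible differentiability of the gradient of the Legendre transform, the
dual point is a point of second order differentiability. -/
lemma hasSpecExpansion_dualPoint (hf : StrongConvexOn (ball 0 1.2) c f) (hc : 0 < c)
    (hfc : ContinuousOn f (ball 0 1.2)) {y : EuclideanSpace ℝ (Fin n)} (hy : y ∈ dualDomain f)
    {T : EuclideanSpace ℝ (Fin n) →L[ℝ] EuclideanSpace ℝ (Fin n)}
    (hT : HasFDerivAt (dualPoint f) T y) (hdet : T.det ≠ 0) :
    ∃ b w, (∀ i, c ≤ w i) ∧ HasSpecExpansion f (dualPoint f y) y b w := by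
  have hF : ∀ᶠ z in 𝓝 y, HasFDerivAt (legendre f) (innerSL ℝ (dualPoint f z)) z := by
    filter_upwards [(isOpen_dualDomain hf hc hfc).mem_nhds hy] with z hz
    exact hasFDerivAt_legendre hf hc hfc hz
  obtain ⟨b, τ, hτ, hτc, hTτ⟩ := exists_basis_of_isSymmetric hc
    (isSymmetric_of_hasFDerivAt_gradient hF hT) hdet (le_inner_fderiv_dualPoint hf hc hfc hy hT)
  obtain ⟨κ, hκ, hκτ⟩ := exists_pos_le_of_pos hτ
  set a := dualPoint f y with ha
  obtain ⟨ha1, hya⟩ := dualPoint_spec hy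
  rw [← ha] at ha1 hya
  have hleg := legendre_eq_of_mem hfc ha1 hya
  have hball : ∀ᶠ h in 𝓝 (0 : EuclideanSpace ℝ (Fin n)), a + h ∈ ball 0 1 := by
    have : Continuous fun h => a + h := by fun_prop
    exact (this.tendsto' 0 a (by simp)).eventually_mem (isOpen_ball.mem_nhds ha1)
  refine ⟨b, fun i => (τ i)⁻¹, hτc, fun η hη => ?_⟩
  -- the lower bound
  have hlower : ∀ᶠ h in 𝓝 (0 : EuclideanSpace ℝ (Fin n)),
      f a + inner ℝ y h + 1 / 2 * specForm b (fun i => (τ i)⁻¹) h - η * ‖h‖ ^ 2 ≤ f (a + h) := by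
    -- S is the inverse of T, so `y + S h` is the expected gradient at a + h; Fenchel's inequality
    -- with this slope gives the optimal quadratic term.
    set S := specMap b fun i => (τ i)⁻¹ with hS
    have hη' : 0 < η / (‖S‖ ^ 2 + 1) := by positivity
    have hS0 : Tendsto S (𝓝 0) (𝓝 0) := S.continuous.tendsto' 0 0 (map_zero S)
    filter_upwards [hball,
      hS0.eventually (eventually_abs_sub_le_of_hasFDerivAt_gradient hF hT hη')] with h hh h1
    have h2 := (abs_le.1 h1).2
    have h3 := le_legendre hfc hh (y + S h)
    have h4 : inner ℝ (T (S h)) (S h) = specForm b (fun i => (τ i)⁻¹) h := by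
      rw [hTτ, specForm, specForm]
      refine Finset.sum_congr rfl fun i _ => ?_
      rw [hS, inner_basis_specMap]
      have := (hτ i).ne'
      field_simp
    have h5 : inner ℝ (S h) h = specForm b (fun i => (τ i)⁻¹) h := inner_specMap _ _ _
    have h6 : η / (‖S‖ ^ 2 + 1) * ‖S h‖ ^ 2 ≤ η * ‖h‖ ^ 2 := by
      have : ‖S h‖ ^ 2 ≤ (‖S‖ ^ 2 + 1) * ‖h‖ ^ 2 := by
        calc ‖S h‖ ^ 2 ≤ (‖S‖ * ‖h‖) ^ 2 := by gcongr; exact S.le_opNorm h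
          _ = ‖S‖ ^ 2 * ‖h‖ ^ 2 := mul_pow _ _ _
          _ ≤ _ := by gcongr; linarith
      calc _ ≤ η / (‖S‖ ^ 2 + 1) * ((‖S‖ ^ 2 + 1) * ‖h‖ ^ 2) := by gcongr
        _ = _ := by field_simp
    rw [h4, hleg, ← ha] at h2
    rw [inner_add_left, inner_add_right, inner_add_right, h5, real_inner_comm a (S h)] at h3
    linarith
  -- the upper bound
  have hupper : ∀ᶠ h in 𝓝 (0 : EuclideanSpace ℝ (Fin n)),
      f (a + h) ≤ f a + inner ℝ y h + 1 / 2 * specForm b (fun i => (τ i)⁻¹) h + η * ‖h‖ ^ 2 := by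
    -- The first bound keeps `τ i - 2 * η'` above κ/2; the second keeps the change of its inverse
    -- below 2η.
    set η' := min (κ / 4) (η * κ ^ 2 / 2) with hη'
    have hη'0 : 0 < η' := lt_min (by positivity) (by positivity)
    have hη'1 : η' ≤ κ / 4 := min_le_left _ _
    have hη'2 : η' ≤ η * κ ^ 2 / 2 := min_le_right _ _
    obtain ⟨r, hr, hrb⟩ := Metric.nhds_basis_closedBall.eventually_iff.1
      (eventually_abs_sub_le_of_hasFDerivAt_gradient hF hT hη'0)
    have hν : ∀ i, κ / 2 ≤ τ i + (-(2 * η')) := fun i => by linarith [hκτ i]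
    have hsmall : ∀ᶠ h in 𝓝 (0 : EuclideanSpace ℝ (Fin n)), h ∈ closedBall 0 (κ / 2 * r / 2) :=
      closedBall_mem_nhds _ (by positivity)
    filter_upwards [hball, hsmall] with h hh hhs
    -- Equality in Fenchel's inequality at q expresses f(a + h) through the Legendre transform,
    -- whose quadratic lower bound at y dualizes to an upper bound.
    obtain ⟨q, hq⟩ := exists_subgradient isOpen_ball (hf.strictConvexOn hc).convexOn
      (unitBall_subset hh)
    have h1 := legendre_eq_of_mem hfc hh hq
    have h2 := inner_sub_le_of_specForm_le (convexOn_legendre hfc) (x₀ := y) (p := a)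
      (mem_univ y) b (half_pos hκ) hν hr (fun k hk _ => by
        have h3 := (abs_le.1 (hrb (mem_closedBall_zero_iff.2 hk))).1
        rw [hTτ] at h3
        rw [specForm_add, specForm_const]
        linarith) (k := h) (mem_closedBall_zero_iff.1 hhs) (mem_univ q)
    have h4 : specForm b (fun i => (τ i + (-(2 * η')))⁻¹) h ≤
        specForm b (fun i => (τ i)⁻¹) h + 2 * η * ‖h‖ ^ 2 := by
      rw [← specForm_const b, ← specForm_add]
      refine specForm_mono b (fun i => ?_) h
      have hpos : 0 < τ i + (-(2 * η')) := (half_pos hκ).trans_le (hν i)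
      have h5 : (τ i + (-(2 * η')))⁻¹ - (τ i)⁻¹ = 2 * η' / (τ i * (τ i + (-(2 * η')))) := by
        have := (hτ i).ne'
        have := hpos.ne'
        field_simp
        ring
      have h6 : 2 * η' / (τ i * (τ i + (-(2 * η')))) ≤ 2 * η' / (κ * (κ / 2)) := by
        gcongr
        · exact (hτ i).le
        · exact hκτ i
        · exact hν i
      have h7 : 2 * η' / (κ * (κ / 2)) ≤ 2 * η := by
        rw [div_le_iff₀ (by positivity)]
        linarith
      linarith
    rw [hleg, h1, real_inner_comm q, real_inner_comm y a, real_inner_comm y h] at h2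
    linarith
  filter_upwards [hlower, hupper] with h h1 h2
  rw [abs_le]
  constructor <;> linarith

/-- Alexandrov's theorem for strongly convex functions. -/
lemma ae_exists_hasSpecExpansion (hf : StrongConvexOn (ball 0 1.2) c f) (hc : 0 < c)
    (hfc : ContinuousOn f (ball 0 1.2)) :
    ∀ᵐ x : EuclideanSpace ℝ (Fin n), x ∈ ball 0 1 →
      ∃ p b w, (∀ i, c ≤ w i) ∧ HasSpecExpansion f x p b w := by
  set Ω := dualDomain f with hΩ
  have hΩo : IsOpen Ω := isOpen_dualDomain hf hc hfc
  have hlip := lipschitzOnWith_dualPoint hf hc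
  set E₀ := {y ∈ Ω | ¬ DifferentiableAt ℝ (dualPoint f) y} with hE₀
  set E₁ := {y ∈ Ω | DifferentiableAt ℝ (dualPoint f) y ∧
    (fderiv ℝ (dualPoint f) y).det = 0} with hE₁
  -- Hausdorff measure controls Lipschitz images, and Lebesgue measure is absolutely continuous with
  -- respect to it. Rademacher's theorem makes `E₀` null; a Sard-type theorem handles the image of
  -- `E₁`.
  let μ : Measure (EuclideanSpace ℝ (Fin n)) := Measure.hausdorffMeasure n
  have hμ : (volume : Measure (EuclideanSpace ℝ (Fin n))) ≪ μ :=
    Measure.absolutelyContinuous_isAddHaarMeasure _ _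
  have h0 : μ E₀ = 0 := by
    have := hlip.ae_differentiableWithinAt_of_mem (μ := μ)
    refine measure_mono_null (fun y hy => ?_) this
    intro hcon
    exact hy.2 ((hcon hy.1).differentiableAt (hΩo.mem_nhds hy.1))
  have h0' : volume (dualPoint f '' E₀) = 0 := by
    apply hμ
    have := (hlip.mono (sep_subset Ω _)).hausdorffMeasure_image_le (s := E₀)
      (Nat.cast_nonneg n : (0 : ℝ) ≤ n)
    refine le_antisymm (this.trans ?_) zero_le
    change _ * μ E₀ ≤ 0
    rw [h0, mul_zero]
  have h1' : volume (dualPoint f '' E₁) = 0 :=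
    addHaar_image_eq_zero_of_det_fderivWithin_eq_zero volume
      (fun y hy => hy.2.1.hasFDerivAt.hasFDerivWithinAt) fun y hy => hy.2.2
  filter_upwards [compl_mem_ae_iff.2 h0', compl_mem_ae_iff.2 h1'] with x hx0 hx1 hx
  obtain ⟨y, hy⟩ := exists_subgradient isOpen_ball (hf.strictConvexOn hc).convexOn
    (unitBall_subset hx)
  have hyΩ : y ∈ Ω := mem_dualDomain.2 ⟨x, hx, hy⟩
  have hyx : dualPoint f y = x := dualPoint_eq hf hc hx hy
  have hd : DifferentiableAt ℝ (dualPoint f) y := by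
    by_contra hcon
    exact hx0 ⟨y, ⟨hyΩ, hcon⟩, hyx⟩
  have hdet : (fderiv ℝ (dualPoint f) y).det ≠ 0 := fun hcon => hx1 ⟨y, ⟨hyΩ, hd, hcon⟩, hyx⟩
  obtain ⟨b, w, hw, hexp⟩ := hasSpecExpansion_dualPoint hf hc hfc hyΩ hd.hasFDerivAt hdet
  rw [hyx] at hexp
  exact ⟨y, b, w, hw, hexp⟩

end Alexandrov

/-! ### The pointwise inequality at points of twice differentiability. -/

section ViscosityAE

open Set Metric Filter Topology MeasureTheory

variable {n : ℕ}

lemma quadraticFn_add {A : Matrix (Fin n) (Fin n) ℝ} (hA : A.IsHermitian)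
    (p : EuclideanSpace ℝ (Fin n)) (β : ℝ) (x h : EuclideanSpace ℝ (Fin n)) :
    quadraticFn A p β (x + h) = quadraticFn A p β x +
      inner ℝ (p + WithLp.toLp 2 (A.mulVec x.ofLp)) h + 1 / 2 * quadForm A h := by
  have hq : ∀ y, quadraticFn A p β y = β + inner ℝ p y + 1 / 2 * quadForm A y := fun y => rfl
  have h1 : quadForm A (x + h) = quadForm A x +
      2 * inner ℝ (WithLp.toLp 2 (A.mulVec x.ofLp)) h + quadForm A h := by
    have h2 := inner_mulVec_comm hA x h
    rw [quadForm_eq_inner, quadForm_eq_inner, quadForm_eq_inner, WithLp.ofLp_add,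
      Matrix.mulVec_add, WithLp.toLp_add, inner_add_left, inner_add_right, inner_add_right, h2,
      real_inner_comm (WithLp.toLp 2 (A.mulVec x.ofLp)) h]
    ring
  rw [hq, hq, h1, inner_add_right, inner_add_left]
  ring

lemma exists_quadraticFn_eq {A : Matrix (Fin n) (Fin n) ℝ} (hA : A.IsHermitian)
    (x p : EuclideanSpace ℝ (Fin n)) (t : ℝ) :
    ∃ q β, ∀ h, quadraticFn A q β (x + h) = t + inner ℝ p h + 1 / 2 * quadForm A h := by
  refine ⟨p - WithLp.toLp 2 (A.mulVec x.ofLp),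
    t - quadraticFn A (p - WithLp.toLp 2 (A.mulVec x.ofLp)) 0 x, fun h => ?_⟩
  rw [quadraticFn_add hA, sub_add_cancel]
  simp only [quadraticFn]
  ring

/-- At a point of second order differentiability, a viscosity subsolution satisfies the
equation's inequality pointwise. -/
lemma IsViscositySubsolution.le_sum_arctan {Θ : ℝ} {Ω : Set (EuclideanSpace ℝ (Fin n))}
    {u : EuclideanSpace ℝ (Fin n) → ℝ} (hu : IsViscositySubsolution Θ Ω u)
    {x p : EuclideanSpace ℝ (Fin n)} (hx : x ∈ Ω)
    {b : OrthonormalBasis (Fin n) ℝ (EuclideanSpace ℝ (Fin n))} {w : Fin n → ℝ}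
    (h : HasSpecExpansion u x p b w) : Θ ≤ ∑ i, Real.arctan (w i) := by
  have key : ∀ η > 0, Θ ≤ ∑ i, Real.arctan (w i) + n * η := by
    intro η hη
    -- Raising every eigenvalue by η turns the expansion into genuine contact from above; the phase
    -- grows by at most `n * η`.
    have hA := specMatrix_isHermitian b fun i => w i + η
    obtain ⟨q, β, hq⟩ := exists_quadraticFn_eq hA x p (u x)
    have h1 : Θ ≤ lagrangianPhase hA := by
      refine hu.2 x hx _ hA q β ?_ ?_
      · have := hq 0
        rw [add_zero] at this
        rw [this]
        simp [quadForm]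
      · refine eventually_nhdsWithin_of_eventually_nhds ?_
        have hsub : Tendsto (fun z => z - x) (𝓝 x) (𝓝 0) := by
          have : Continuous fun z => z - x := by fun_prop
          exact this.tendsto' x 0 (by simp)
        filter_upwards [hsub.eventually (h (η / 2) (half_pos hη))] with z hz
        have h2 := (abs_le.1 hz).2
        rw [add_sub_cancel] at h2
        have h3 := hq (z - x)
        rw [add_sub_cancel, quadForm_specMatrix, specForm_add, specForm_const] at h3
        rw [h3]
        linarith
    have h2 := lagrangianPhase_le_of_quadForm_le hA b fun x => (quadForm_specMatrix b _ x).le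
    have h3 : ∑ i, Real.arctan (w i + η) ≤ ∑ i, (Real.arctan (w i) + η) :=
      Finset.sum_le_sum fun i _ => arctan_add_le _ hη.le
    rw [Finset.sum_add_distrib] at h3
    simp only [Finset.sum_const, Finset.card_univ, Fintype.card_fin, nsmul_eq_mul] at h3
    linarith
  refine le_of_forall_pos_le_add fun ε hε => ?_
  have := key (ε / (n + 1)) (by positivity)
  have h4 : n * (ε / (n + 1)) ≤ ε := by
    rw [mul_div_assoc', div_le_iff₀ (by positivity)]
    nlinarith
  linarith

lemma strongConvexOn_tildePotential {α : ℝ} (hs : 0 < Real.sin α)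
    {u : EuclideanSpace ℝ (Fin n) → ℝ} {D : Set (EuclideanSpace ℝ (Fin n))}
    (hu : ConvexOn ℝ D u) : StrongConvexOn D (Real.cos α) (tildePotential α u) := by
  rw [strongConvexOn_iff_convex]
  refine (hu.smul hs.le).congr fun x _ => ?_
  simp [tildePotential]

lemma continuousOn_tildePotential {α : ℝ} {u : EuclideanSpace ℝ (Fin n) → ℝ}
    {D : Set (EuclideanSpace ℝ (Fin n))} (hu : ContinuousOn u D) :
    ContinuousOn (tildePotential α u) D := by
  unfold tildePotential
  fun_prop

lemma HasSpecExpansion.of_tildePotential {α : ℝ} (hs : 0 < Real.sin α)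
    {u : EuclideanSpace ℝ (Fin n) → ℝ} {x p : EuclideanSpace ℝ (Fin n)}
    {b : OrthonormalBasis (Fin n) ℝ (EuclideanSpace ℝ (Fin n))} {w : Fin n → ℝ}
    (h : HasSpecExpansion (tildePotential α u) x p b w) :
    HasSpecExpansion u x ((Real.sin α)⁻¹ • (p - Real.cos α • x)) b
      (fun i => (Real.sin α)⁻¹ * (w i + -Real.cos α)) := by
  intro η hη
  filter_upwards [h (Real.sin α * η) (mul_pos hs hη)] with k hk
  have heq : tildePotential α u (x + k) - tildePotential α u x - inner ℝ p k -
      1 / 2 * specForm b w k = Real.sin α * (u (x + k) - u x -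
      inner ℝ ((Real.sin α)⁻¹ • (p - Real.cos α • x)) k -
      1 / 2 * specForm b (fun i => (Real.sin α)⁻¹ * (w i + -Real.cos α)) k) := by
    rw [specForm_const_mul, specForm_add, specForm_const, real_inner_smul_left, inner_sub_left,
      real_inner_smul_left]
    simp only [tildePotential]
    rw [norm_add_sq_real]
    field_simp
    ring
  rw [heq, abs_mul, abs_of_pos hs, mul_assoc] at hk
  exact le_of_mul_le_mul_left hk hs

/-- `v` has at `x` the second order expansion with gradient `p` and Hessian `W`. -/
def HasQuadExpansion (v : EuclideanSpace ℝ (Fin n) → ℝ) (x p : EuclideanSpace ℝ (Fin n))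
    (W : Matrix (Fin n) (Fin n) ℝ) : Prop :=
  ∀ η > 0, ∀ᶠ h in 𝓝 (0 : EuclideanSpace ℝ (Fin n)),
    |v (x + h) - v x - inner ℝ p h - 1 / 2 * quadForm W h| ≤ η * ‖h‖ ^ 2

/-- `v` has at `x` a second order expansion with a positive semidefinite Hessian of phase at
least `Θ`. -/
def IsRegularSubsolutionAt (Θ : ℝ) (v : EuclideanSpace ℝ (Fin n) → ℝ)
    (x : EuclideanSpace ℝ (Fin n)) : Prop :=
  ∃ (p : EuclideanSpace ℝ (Fin n)) (W : Matrix (Fin n) (Fin n) ℝ) (hW : W.IsHermitian),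
    (∀ h, 0 ≤ quadForm W h) ∧ Θ ≤ lagrangianPhase hW ∧ HasQuadExpansion v x p W

lemma sum_arctan_le_lagrangianPhase {A : Matrix (Fin n) (Fin n) ℝ} (hA : A.IsHermitian)
    (b : OrthonormalBasis (Fin n) ℝ (EuclideanSpace ℝ (Fin n))) {w : Fin n → ℝ}
    (h : ∀ x, specForm b w x ≤ quadForm A x) :
    ∑ i, Real.arctan (w i) ≤ lagrangianPhase hA :=
  sum_le_sum_of_specForm_le b hA.eigenvectorBasis
    (fun x => by rw [← quadForm_eq_specForm hA]; exact h x) Real.arctan_mono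

/-- Alexandrov's theorem is applied to ũ. Its Hessian eigenvalues are at least c, which is exactly
what makes the Hessian of u positive semidefinite. -/
lemma ae_isRegularSubsolutionAt {Θ α : ℝ} (hs : 0 < Real.sin α) (hc : 0 < Real.cos α)
    {u : EuclideanSpace ℝ (Fin n) → ℝ} (hconv : ConvexOn ℝ (ball 0 1.2) u)
    (hsub : IsViscositySubsolution Θ (ball 0 1.2) u) :
    ∀ᵐ x : EuclideanSpace ℝ (Fin n), x ∈ ball 0 1 → IsRegularSubsolutionAt Θ u x := by
  filter_upwards [ae_exists_hasSpecExpansion (strongConvexOn_tildePotential hs hconv) hc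
    (continuousOn_tildePotential hsub.1)] with x hx hx1
  obtain ⟨p, b, w, hw, hexp⟩ := hx hx1
  have hexp' := hexp.of_tildePotential hs
  refine ⟨(Real.sin α)⁻¹ • (p - Real.cos α • x), _,
    specMatrix_isHermitian b fun i => (Real.sin α)⁻¹ * (w i + -Real.cos α),
    fun h => ?_, ?_, fun η hη => ?_⟩
  · rw [quadForm_specMatrix]
    refine Finset.sum_nonneg fun i _ => mul_nonneg (mul_nonneg (inv_pos.2 hs).le ?_) (sq_nonneg _)
    linarith [hw i]
  · exact (hsub.le_sum_arctan (unitBall_subset hx1) hexp').trans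
      (sum_arctan_le_lagrangianPhase _ b fun x => (quadForm_specMatrix b _ x).ge)
  · filter_upwards [hexp' η hη] with h hh
    rwa [quadForm_specMatrix]

end ViscosityAE

/-! ### Measurable Hessians, truncation and Jensen's inequality. -/

section Averaging

open Set Metric Filter Topology MeasureTheory

variable {n : ℕ}

lemma HasQuadExpansion.hasFDerivAt {v : EuclideanSpace ℝ (Fin n) → ℝ}
    {x p : EuclideanSpace ℝ (Fin n)} {W : Matrix (Fin n) (Fin n) ℝ}
    (h : HasQuadExpansion v x p W) : HasFDerivAt v (innerSL ℝ p) x := by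
  rw [hasFDerivAt_iff_isLittleO_nhds_zero]
  have hq : (fun k => 1 / 2 * quadForm W k) =O[𝓝 (0 : EuclideanSpace ℝ (Fin n))]
      fun k => ‖k‖ ^ 2 := by
    refine Asymptotics.IsBigO.of_bound (1 / 2 * ∑ k, ∑ l, |W k l|) (Eventually.of_forall fun h => ?_)
    rw [norm_mul, Real.norm_of_nonneg (by norm_num : (0 : ℝ) ≤ 1 / 2), norm_pow, norm_norm,
      mul_assoc, quadForm_eq_sum, Real.norm_eq_abs, Finset.sum_mul]
    refine mul_le_mul_of_nonneg_left ?_ (by norm_num)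
    refine (Finset.abs_sum_le_sum_abs _ _).trans (Finset.sum_le_sum fun k _ => ?_)
    rw [Finset.sum_mul]
    refine (Finset.abs_sum_le_sum_abs _ _).trans (Finset.sum_le_sum fun l _ => ?_)
    rw [abs_mul, abs_mul, sq]
    have h1 := PiLp.norm_apply_le h k
    have h2 := PiLp.norm_apply_le h l
    rw [Real.norm_eq_abs] at h1 h2
    gcongr
  have h1 : (fun k => v (x + k) - v x - inner ℝ p k - 1 / 2 * quadForm W k)
      =O[𝓝 (0 : EuclideanSpace ℝ (Fin n))] fun k => ‖k‖ ^ 2 := by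
    refine Asymptotics.IsBigO.of_bound 1 ?_
    filter_upwards [h 1 one_pos] with k hk
    simpa using hk
  have h2 := (h1.add hq).trans_isLittleO (Asymptotics.isLittleO_norm_pow_id one_lt_two)
  refine h2.congr_left fun k => ?_
  simp

/-- This is the source of measurability: Hessian forms are limits of continuous functions of the
base point. -/
lemma HasQuadExpansion.tendsto_second_difference {v : EuclideanSpace ℝ (Fin n) → ℝ}
    {x p : EuclideanSpace ℝ (Fin n)} {W : Matrix (Fin n) (Fin n) ℝ}
    (h : HasQuadExpansion v x p W) (e : EuclideanSpace ℝ (Fin n)) :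
    Tendsto (fun k : ℕ => ((k : ℝ) + 1) ^ 2 * (v (x + ((k : ℝ) + 1)⁻¹ • e) +
      v (x + -(((k : ℝ) + 1)⁻¹ • e)) - 2 * v x)) atTop (𝓝 (quadForm W e)) := by
  rw [Metric.tendsto_atTop']
  intro ε hε
  have hη : 0 < ε / (2 * ‖e‖ ^ 2 + 1) / 2 := by positivity
  have hlim : Tendsto (fun k : ℕ => ((k : ℝ) + 1)⁻¹ • e) atTop (𝓝 0) := by
    have h1 : Tendsto (fun k : ℕ => ((k : ℝ) + 1)⁻¹) atTop (𝓝 0) := by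
      simpa using tendsto_one_div_add_atTop_nhds_zero_nat (𝕜 := ℝ)
    simpa using h1.smul_const e
  have hlim' : Tendsto (fun k : ℕ => -(((k : ℝ) + 1)⁻¹ • e)) atTop (𝓝 0) := by
    simpa using hlim.neg
  obtain ⟨N, hN⟩ := eventually_atTop.1 ((hlim.eventually (h _ hη)).and (hlim'.eventually (h _ hη)))
  refine ⟨N, fun k hk => ?_⟩
  obtain ⟨h1, h2⟩ := hN k hk.le
  set t : ℝ := (k : ℝ) + 1 with ht
  have ht0 : 0 < t := by positivity
  rw [← neg_smul, quadForm_smul, norm_smul, Real.norm_eq_abs, abs_neg, neg_sq,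
    real_inner_smul_right] at h2
  rw [quadForm_smul, norm_smul, Real.norm_eq_abs, real_inner_smul_right] at h1
  rw [mul_pow, sq_abs] at h1 h2
  rw [← neg_smul, Real.dist_eq]
  set A := v (x + t⁻¹ • e)
  set B := v (x + -t⁻¹ • e)
  have h3 : |A + B - 2 * v x - t⁻¹ ^ 2 * quadForm W e| ≤
      2 * (ε / (2 * ‖e‖ ^ 2 + 1) / 2 * (t⁻¹ ^ 2 * ‖e‖ ^ 2)) := by
    rw [abs_le] at h1 h2 ⊢
    constructor <;> linarith [h1.1, h1.2, h2.1, h2.2]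
  have h4 : t ^ 2 * (A + B - 2 * v x) - quadForm W e =
      t ^ 2 * (A + B - 2 * v x - t⁻¹ ^ 2 * quadForm W e) := by
    field_simp
  rw [h4, abs_mul, abs_of_pos (by positivity)]
  calc _ ≤ t ^ 2 * (2 * (ε / (2 * ‖e‖ ^ 2 + 1) / 2 * (t⁻¹ ^ 2 * ‖e‖ ^ 2))) := by gcongr
    _ = ε * (‖e‖ ^ 2 / (2 * ‖e‖ ^ 2 + 1)) := by field_simp
    _ < ε * 1 := by
      gcongr
      rw [div_lt_one (by positivity)]
      nlinarith [sq_nonneg ‖e‖]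
    _ = ε := mul_one ε

lemma entry_eq_quadForm {A : Matrix (Fin n) (Fin n) ℝ} (hA : A.IsHermitian) (i j : Fin n) :
    A i j = 1 / 2 * (quadForm A (EuclideanSpace.single i 1 + EuclideanSpace.single j 1) -
      quadForm A (EuclideanSpace.single i 1) - quadForm A (EuclideanSpace.single j 1)) := by
  have hji : A j i = A i j := by simpa using hA.apply i j
  have hs : ∀ (i : Fin n), (EuclideanSpace.single i (1 : ℝ)).ofLp = Pi.single i 1 := fun i => rfl
  simp only [quadForm, WithLp.ofLp_add, hs, Matrix.mulVec_add, add_dotProduct, dotProduct_add,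
    Matrix.mulVec_single_one, single_one_dotProduct, Matrix.col_apply]
  rw [hji]
  ring

/-- A measurable choice of the Hessians at almost all translates of a point. -/
lemma exists_aemeasurable_hessian {Θ : ℝ} {v : EuclideanSpace ℝ (Fin n) → ℝ}
    (hv : Continuous v) {P : Measure (EuclideanSpace ℝ (Fin n))} {a : EuclideanSpace ℝ (Fin n)}
    (hreg : ∀ᵐ z ∂P, IsRegularSubsolutionAt Θ v (a + z)) :
    ∃ W : EuclideanSpace ℝ (Fin n) → Matrix (Fin n) (Fin n) ℝ,
      (∀ i j, AEMeasurable (fun z => W z i j) P) ∧ (∀ z h, 0 ≤ quadForm (W z) h) ∧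
      ∃ hW : ∀ z, (W z).IsHermitian, ∀ᵐ z ∂P, Θ ≤ lagrangianPhase (hW z) ∧
        ∃ p, HasQuadExpansion v (a + z) p (W z) := by
  have hch : ∀ z, ∃ W : Matrix (Fin n) (Fin n) ℝ, ∃ hW : W.IsHermitian,
      (∀ h, 0 ≤ quadForm W h) ∧ (IsRegularSubsolutionAt Θ v (a + z) →
        Θ ≤ lagrangianPhase hW ∧ ∃ p, HasQuadExpansion v (a + z) p W) := by
    intro z
    by_cases h : IsRegularSubsolutionAt Θ v (a + z)
    · obtain ⟨p, W, hW, h1, h2, h3⟩ := h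
      exact ⟨W, hW, h1, fun _ => ⟨h2, p, h3⟩⟩
    -- The default value 0 keeps positivity valid at every z, not merely almost everywhere.
    · exact ⟨0, Matrix.isHermitian_zero, fun x => by simp [quadForm], fun h' => absurd h' h⟩
  choose W hW hpos hexp using hch
  have hquad : ∀ e, AEMeasurable (fun z => quadForm (W z) e) P := by
    intro e
    refine aemeasurable_of_tendsto_metrizable_ae atTop
      (f := fun (k : ℕ) z => ((k : ℝ) + 1) ^ 2 * (v (a + z + ((k : ℝ) + 1)⁻¹ • e) +
      v (a + z + -(((k : ℝ) + 1)⁻¹ • e)) - 2 * v (a + z))) (fun k => ?_) ?_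
    · have : Continuous fun z => ((k : ℝ) + 1) ^ 2 * (v (a + z + ((k : ℝ) + 1)⁻¹ • e) +
        v (a + z + -(((k : ℝ) + 1)⁻¹ • e)) - 2 * v (a + z)) := by fun_prop
      exact this.aemeasurable
    · filter_upwards [hreg] with z hz
      obtain ⟨p, hp⟩ := (hexp z hz).2
      exact hp.tendsto_second_difference e
  refine ⟨W, fun i j => ?_, hpos, hW, ?_⟩
  · have : (fun z => W z i j) = fun z => 1 / 2 *
      (quadForm (W z) (EuclideanSpace.single i 1 + EuclideanSpace.single j 1) -
      quadForm (W z) (EuclideanSpace.single i 1) - quadForm (W z) (EuclideanSpace.single j 1)) :=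
      funext fun z => entry_eq_quadForm (hW z) i j
    rw [this]
    exact (((hquad _).sub (hquad _)).sub (hquad _)).const_mul _
  · filter_upwards [hreg] with z hz using hexp z hz

open Classical in
/-- The matrix `A` if its entries are bounded by `K`, and `0` otherwise. -/
noncomputable def truncMatrix (K : ℝ) (A : Matrix (Fin n) (Fin n) ℝ) : Matrix (Fin n) (Fin n) ℝ :=
  if ∀ i j, |A i j| ≤ K then A else 0

lemma truncMatrix_isHermitian (K : ℝ) {A : Matrix (Fin n) (Fin n) ℝ} (hA : A.IsHermitian) :
    (truncMatrix K A).IsHermitian := by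
  unfold truncMatrix
  split_ifs
  · exact hA
  · exact Matrix.isHermitian_zero

lemma abs_truncMatrix_le {K : ℝ} (hK : 0 ≤ K) (A : Matrix (Fin n) (Fin n) ℝ) (i j : Fin n) :
    |truncMatrix K A i j| ≤ K := by
  unfold truncMatrix
  split_ifs with h
  · exact h i j
  · simpa using hK

lemma quadForm_zero (x : EuclideanSpace ℝ (Fin n)) : quadForm 0 x = 0 := by simp [quadForm]

/-- Replacing a positive semidefinite matrix by 0 only lowers its form, so truncation secures
integrability while keeping lower bounds. -/
lemma quadForm_truncMatrix_le (K : ℝ) {A : Matrix (Fin n) (Fin n) ℝ}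
    (hA : ∀ h, 0 ≤ quadForm A h) (h : EuclideanSpace ℝ (Fin n)) :
    quadForm (truncMatrix K A) h ≤ quadForm A h := by
  unfold truncMatrix
  split_ifs
  · exact le_rfl
  · rw [quadForm_zero]; exact hA h

lemma quadForm_truncMatrix_nonneg (K : ℝ) {A : Matrix (Fin n) (Fin n) ℝ}
    (hA : ∀ h, 0 ≤ quadForm A h) (h : EuclideanSpace ℝ (Fin n)) :
    0 ≤ quadForm (truncMatrix K A) h := by
  unfold truncMatrix
  split_ifs
  · exact hA h
  · rw [quadForm_zero]

lemma abs_quadForm_le {K : ℝ} {A : Matrix (Fin n) (Fin n) ℝ} (hA : ∀ i j, |A i j| ≤ K)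
    (h : EuclideanSpace ℝ (Fin n)) : |quadForm A h| ≤ n * (n * K) * ‖h‖ ^ 2 := by
  rw [quadForm_eq_sum]
  have h1 : ∀ k l, |A k l * (h.ofLp k * h.ofLp l)| ≤ K * ‖h‖ ^ 2 := by
    intro k l
    rw [abs_mul, abs_mul, sq]
    have h1 := PiLp.norm_apply_le h k
    have h2 := PiLp.norm_apply_le h l
    rw [Real.norm_eq_abs] at h1 h2
    have := (abs_nonneg _).trans (hA k l)
    gcongr
    exact hA k l
  calc _ ≤ ∑ k : Fin n, ∑ l : Fin n, K * ‖h‖ ^ 2 :=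
        (Finset.abs_sum_le_sum_abs _ _).trans (Finset.sum_le_sum fun k _ =>
          (Finset.abs_sum_le_sum_abs _ _).trans (Finset.sum_le_sum fun l _ => h1 k l))
    _ = _ := by
        simp only [Finset.sum_const, Finset.card_univ, Fintype.card_fin, nsmul_eq_mul]
        ring

section

variable {P : Measure (EuclideanSpace ℝ (Fin n))}
  {W : EuclideanSpace ℝ (Fin n) → Matrix (Fin n) (Fin n) ℝ}

lemma nullMeasurableSet_forall_abs_le (hmeas : ∀ i j, AEMeasurable (fun z => W z i j) P) (K : ℝ) :
    NullMeasurableSet {z | ∀ i j, |W z i j| ≤ K} P := by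
  have : {z | ∀ i j, |W z i j| ≤ K} = ⋂ i, ⋂ j, {z | |W z i j| ≤ K} := by
    ext z; simp
  rw [this]
  refine NullMeasurableSet.iInter fun i => NullMeasurableSet.iInter fun j => ?_
  exact nullMeasurableSet_le (hmeas i j).abs aemeasurable_const

lemma aemeasurable_truncMatrix (hmeas : ∀ i j, AEMeasurable (fun z => W z i j) P) (K : ℝ)
    (i j : Fin n) : AEMeasurable (fun z => truncMatrix K (W z) i j) P := by
  classical
  have : (fun z => truncMatrix K (W z) i j) =
      {z | ∀ i j, |W z i j| ≤ K}.indicator fun z => W z i j := by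
    funext z
    by_cases h : ∀ i j, |W z i j| ≤ K
    · rw [indicator_of_mem (by exact h), truncMatrix, if_pos h]
    · rw [indicator_of_notMem (by exact h), truncMatrix, if_neg h]; rfl
  rw [this]
  exact (hmeas i j).indicator₀ (nullMeasurableSet_forall_abs_le hmeas K)

lemma integrable_truncMatrix [IsProbabilityMeasure P]
    (hmeas : ∀ i j, AEMeasurable (fun z => W z i j) P) {K : ℝ} (hK : 0 ≤ K) (i j : Fin n) :
    Integrable (fun z => truncMatrix K (W z) i j) P :=
  Integrable.of_bound (aemeasurable_truncMatrix hmeas K i j).aestronglyMeasurable K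
    (Eventually.of_forall fun _ => abs_truncMatrix_le hK _ i j)

/-- The mean of the truncated matrices. -/
noncomputable def meanTrunc (P : Measure (EuclideanSpace ℝ (Fin n)))
    (W : EuclideanSpace ℝ (Fin n) → Matrix (Fin n) (Fin n) ℝ) (K : ℝ) :
    Matrix (Fin n) (Fin n) ℝ :=
  Matrix.of fun i j => ∫ z, truncMatrix K (W z) i j ∂P

lemma meanTrunc_isHermitian (hW : ∀ z, (W z).IsHermitian) (K : ℝ) :
    (meanTrunc P W K).IsHermitian := by
  ext i j
  simp only [meanTrunc, Matrix.conjTranspose_apply, Matrix.of_apply, star_trivial]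
  congr 1
  funext z
  simpa using (truncMatrix_isHermitian K (hW z)).apply i j

lemma integrable_quadForm_truncMatrix [IsProbabilityMeasure P]
    (hmeas : ∀ i j, AEMeasurable (fun z => W z i j) P) {K : ℝ} (hK : 0 ≤ K)
    (h : EuclideanSpace ℝ (Fin n)) : Integrable (fun z => quadForm (truncMatrix K (W z)) h) P := by
  simp only [quadForm_eq_sum]
  exact integrable_finsetSum _ fun k _ => integrable_finsetSum _ fun l _ =>
    (integrable_truncMatrix hmeas hK k l).mul_const _

lemma integral_quadForm_truncMatrix [IsProbabilityMeasure P]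
    (hmeas : ∀ i j, AEMeasurable (fun z => W z i j) P) {K : ℝ} (hK : 0 ≤ K)
    (h : EuclideanSpace ℝ (Fin n)) :
    ∫ z, quadForm (truncMatrix K (W z)) h ∂P = quadForm (meanTrunc P W K) h := by
  simp only [quadForm_eq_sum]
  rw [integral_finsetSum _ fun k _ => integrable_finsetSum _ fun l _ =>
    (integrable_truncMatrix hmeas hK k l).mul_const _]
  refine Finset.sum_congr rfl fun k _ => ?_
  rw [integral_finsetSum _ fun l _ => (integrable_truncMatrix hmeas hK k l).mul_const _]
  refine Finset.sum_congr rfl fun l _ => ?_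
  rw [integral_mul_const]
  rfl

/-- Concavity of the phase on positive semidefinite matrices, along truncated means. -/
lemma exists_le_lagrangianPhase_meanTrunc [IsProbabilityMeasure P] {Θ : ℝ}
    (hmeas : ∀ i j, AEMeasurable (fun z => W z i j) P) (hpos : ∀ z h, 0 ≤ quadForm (W z) h)
    (hW : ∀ z, (W z).IsHermitian) (hΘ : ∀ᵐ z ∂P, Θ ≤ lagrangianPhase (hW z))
    {τ : ℝ} (hτ : 0 < τ) :
    ∃ K : ℝ, 0 ≤ K ∧ Θ - τ ≤ lagrangianPhase (meanTrunc_isHermitian (P := P) hW K) := by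
  classical
  set S : ℕ → Set (EuclideanSpace ℝ (Fin n)) := fun K => {z | ∀ i j, |W z i j| ≤ (K : ℝ)} with hS
  -- Where truncation acts, the matrix is 0 and has phase 0, so Θ survives only on `S K`; these sets
  -- exhaust the space.
  have hlim : Tendsto (fun K : ℕ => ∫ z, (S K).indicator (fun _ => Θ) z ∂P) atTop
      (𝓝 (∫ _, Θ ∂P)) := by
    refine tendsto_integral_of_dominated_convergence (fun _ => |Θ|) (fun K => ?_)
      (integrable_const _) (fun K => Eventually.of_forall fun z => ?_)
      (Eventually.of_forall fun z => ?_)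
    · exact (aemeasurable_const.indicator₀
        (nullMeasurableSet_forall_abs_le hmeas _)).aestronglyMeasurable
    · exact norm_indicator_le_norm_self _ _
    · apply tendsto_const_nhds.congr'
      obtain ⟨N, hN⟩ := exists_nat_ge (∑ i, ∑ j, |W z i j|)
      filter_upwards [eventually_ge_atTop N] with K hK
      rw [indicator_of_mem]
      intro i j
      have h1 : |W z i j| ≤ ∑ j, |W z i j| :=
        Finset.single_le_sum (f := fun j => |W z i j|) (fun _ _ => abs_nonneg _)
          (Finset.mem_univ j)
      have h2 : ∑ j, |W z i j| ≤ ∑ i, ∑ j, |W z i j| :=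
        Finset.single_le_sum (f := fun i => ∑ j, |W z i j|)
          (fun _ _ => Finset.sum_nonneg fun _ _ => abs_nonneg _) (Finset.mem_univ i)
      have h3 : (N : ℝ) ≤ K := by exact_mod_cast hK
      linarith
  rw [integral_const, probReal_univ, one_smul] at hlim
  obtain ⟨K, hK⟩ := (hlim.eventually (lt_mem_nhds (by linarith : Θ - τ < Θ))).exists
  refine ⟨K, Nat.cast_nonneg K, hK.le.trans ?_⟩
  have hK0 : (0 : ℝ) ≤ K := Nat.cast_nonneg K
  set hM := meanTrunc_isHermitian (P := P) hW K
  -- In the eigenbasis of the mean, Peierls' inequality bounds the phase at each z by a sum of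
  -- scalar arctangents, to which Jensen's inequality applies entry by entry.
  set e := hM.eigenvectorBasis
  have harc : ∀ i, Integrable (fun z => Real.arctan (quadForm (truncMatrix K (W z)) (e i))) P := by
    intro i
    refine Integrable.of_bound (C := Real.pi / 2)
      (Real.continuous_arctan.comp_aestronglyMeasurable
        (integrable_quadForm_truncMatrix hmeas hK0 _).aestronglyMeasurable)
      (Eventually.of_forall fun z => ?_)
    rw [Real.norm_eq_abs]
    exact abs_le.2 ⟨(Real.neg_pi_div_two_lt_arctan _).le, (Real.arctan_lt_pi_div_two _).le⟩
  have hjen : ∀ i, ∫ z, Real.arctan (quadForm (truncMatrix K (W z)) (e i)) ∂P ≤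
      Real.arctan (hM.eigenvalues i) := by
    intro i
    have := concaveOn_arctan.le_map_integral Real.continuous_arctan.continuousOn isClosed_Ici
      (Eventually.of_forall fun z => quadForm_truncMatrix_nonneg K (hpos z) (e i))
      (integrable_quadForm_truncMatrix hmeas hK0 (e i)) (harc i)
    rwa [integral_quadForm_truncMatrix hmeas hK0, quadForm_eq_specForm hM, specForm_basis] at this
  calc ∫ z, (S K).indicator (fun _ => Θ) z ∂P
      ≤ ∫ z, ∑ i, Real.arctan (quadForm (truncMatrix K (W z)) (e i)) ∂P := by
        refine integral_mono_ae ?_ (integrable_finsetSum _ fun i _ => harc i) ?_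
        · exact Integrable.of_bound ((aemeasurable_const.indicator₀
            (nullMeasurableSet_forall_abs_le hmeas _)).aestronglyMeasurable) |Θ|
            (Eventually.of_forall fun z => norm_indicator_le_norm_self _ _)
        · filter_upwards [hΘ] with z hz
          by_cases h : z ∈ S K
          · rw [indicator_of_mem h]
            have ht : truncMatrix K (W z) = W z := if_pos h
            rw [ht]
            exact hz.trans (lagrangianPhase_le_sum_arctan_quadForm (hW z) (hpos z) e)
          · rw [indicator_of_notMem h]
            exact Finset.sum_nonneg fun i _ =>
              Real.arctan_nonneg.2 (quadForm_truncMatrix_nonneg K (hpos z) _)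
    _ = ∑ i, ∫ z, Real.arctan (quadForm (truncMatrix K (W z)) (e i)) ∂P :=
        integral_finsetSum _ fun i _ => harc i
    _ ≤ _ := Finset.sum_le_sum fun i _ => hjen i

end

end Averaging

/-! ### Second order lower bounds for averaged convex functions. -/

section MeanValue

open Set Metric Filter Topology MeasureTheory
open scoped NNReal

variable {n : ℕ}

lemma eq_innerSL_of_subgradient {v : EuclideanSpace ℝ (Fin n) → ℝ}
    {x q : EuclideanSpace ℝ (Fin n)} {φ : EuclideanSpace ℝ (Fin n) →L[ℝ] ℝ}
    (hv : HasFDerivAt v φ x) (hq : ∀ᶠ z in 𝓝 x, v x + inner ℝ q (z - x) ≤ v z) :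
    φ = innerSL ℝ q := by
  have hmin : IsLocalMin (fun z => v z - innerSL ℝ q z) x := by
    filter_upwards [hq] with z hz
    rw [innerSL_apply_apply, innerSL_apply_apply]
    rw [inner_sub_right] at hz
    linarith
  have := hmin.hasFDerivAt_eq_zero (hv.sub (innerSL ℝ q).hasFDerivAt)
  exact sub_eq_zero.1 this

lemma le_of_convexOn_of_hasFDerivAt {S : Set (EuclideanSpace ℝ (Fin n))}
    {v : EuclideanSpace ℝ (Fin n) → ℝ} (hS : IsOpen S) (hv : ConvexOn ℝ S v)
    {x : EuclideanSpace ℝ (Fin n)} {φ : EuclideanSpace ℝ (Fin n) →L[ℝ] ℝ} (hx : x ∈ S)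
    (hφ : HasFDerivAt v φ x) {z : EuclideanSpace ℝ (Fin n)} (hz : z ∈ S) :
    v x + φ (z - x) ≤ v z := by
  obtain ⟨q, hq⟩ := exists_subgradient hS hv hx
  have : φ = innerSL ℝ q := eq_innerSL_of_subgradient hφ (by
    filter_upwards [hS.mem_nhds hx] with z hz using hq z hz)
  rw [this, innerSL_apply_apply]
  exact hq z hz

/-- The mean of the translates of `v`, with respect to `P`. -/
noncomputable def meanTranslate (P : Measure (EuclideanSpace ℝ (Fin n)))
    (v : EuclideanSpace ℝ (Fin n) → ℝ) (x : EuclideanSpace ℝ (Fin n)) : ℝ :=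
  ∫ z, v (x + z) ∂P

section

variable {P : Measure (EuclideanSpace ℝ (Fin n))} [IsProbabilityMeasure P]
  {v : EuclideanSpace ℝ (Fin n) → ℝ} {L : ℝ≥0} {ε : ℝ}

lemma integrable_translate (hv : LipschitzWith L v) (hP : ∀ᵐ z ∂P, z ∈ ball 0 ε)
    (x : EuclideanSpace ℝ (Fin n)) : Integrable (fun z => v (x + z)) P := by
  have hc : Continuous fun z => v (x + z) := hv.continuous.comp (by fun_prop)
  refine Integrable.of_bound hc.aestronglyMeasurable (|v x| + L * ε) ?_
  filter_upwards [hP] with z hz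
  have h1 := hv.dist_le_mul (x + z) x
  rw [Real.dist_eq, dist_eq_norm, add_sub_cancel_left] at h1
  have h2 : ‖z‖ ≤ ε := (mem_ball_zero_iff.1 hz).le
  have h3 : (L : ℝ) * ‖z‖ ≤ L * ε := by gcongr
  have h4 := abs_add_le (v x) (v (x + z) - v x)
  rw [add_sub_cancel] at h4
  rw [Real.norm_eq_abs]
  linarith

lemma abs_meanTranslate_sub_le (hv : LipschitzWith L v) (hP : ∀ᵐ z ∂P, z ∈ ball 0 ε)
    (x : EuclideanSpace ℝ (Fin n)) : |meanTranslate P v x - v x| ≤ L * ε := by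
  have h1 : meanTranslate P v x - v x = ∫ z, (v (x + z) - v x) ∂P := by
    rw [integral_sub (integrable_translate hv hP x) (integrable_const _), integral_const,
      probReal_univ, one_smul]
    rfl
  rw [h1, ← Real.norm_eq_abs]
  have := norm_integral_le_of_norm_le_const (μ := P) (f := fun z => v (x + z) - v x)
    (C := L * ε) (by
      filter_upwards [hP] with z hz
      have h1 := hv.dist_le_mul (x + z) x
      rw [Real.dist_eq, dist_eq_norm, add_sub_cancel_left] at h1
      have h2 : ‖z‖ ≤ ε := (mem_ball_zero_iff.1 hz).le
      rw [Real.norm_eq_abs]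
      exact h1.trans (by gcongr))
  rwa [probReal_univ, mul_one] at this

lemma continuous_meanTranslate (hv : LipschitzWith L v) (hP : ∀ᵐ z ∂P, z ∈ ball 0 ε) :
    Continuous (meanTranslate P v) := by
  refine (LipschitzWith.of_dist_le_mul (K := L) fun x y => ?_).continuous
  rw [Real.dist_eq, meanTranslate, meanTranslate,
    ← integral_sub (integrable_translate hv hP x) (integrable_translate hv hP y),
    ← Real.norm_eq_abs]
  have := norm_integral_le_of_norm_le_const (μ := P) (f := fun z => v (x + z) - v (y + z))
    (C := L * dist x y) (Eventually.of_forall fun z => by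
      have h1 := hv.dist_le_mul (x + z) (y + z)
      rwa [dist_add_right, dist_eq_norm] at h1)
  rwa [probReal_univ, mul_one] at this

lemma convexOn_meanTranslate (hv : LipschitzWith L v) (hP : ∀ᵐ z ∂P, z ∈ ball 0 ε)
    {S T : Set (EuclideanSpace ℝ (Fin n))} (hconv : ConvexOn ℝ S v) (hT : Convex ℝ T)
    (hTS : ∀ x ∈ T, ∀ z ∈ ball (0 : EuclideanSpace ℝ (Fin n)) ε, x + z ∈ S) :
    ConvexOn ℝ T (meanTranslate P v) := by
  refine ⟨hT, fun x hx y hy s t hs ht hst => ?_⟩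
  simp only [meanTranslate, smul_eq_mul]
  rw [← integral_const_mul, ← integral_const_mul, ← integral_add
    ((integrable_translate hv hP x).const_mul s) ((integrable_translate hv hP y).const_mul t)]
  refine integral_mono_ae (integrable_translate hv hP _)
    (((integrable_translate hv hP x).const_mul s).add
      ((integrable_translate hv hP y).const_mul t)) ?_
  filter_upwards [hP] with z hz
  have h1 := hconv.2 (hTS x hx z hz) (hTS y hy z hz) hs ht hst
  have h2 : s • (x + z) + t • (y + z) = s • x + t • y + z := by
    rw [smul_add, smul_add, add_add_add_comm, ← add_smul, hst, one_smul]
  rw [h2] at h1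
  exact h1

/-- At every point, the mean of the translates of a convex function that is almost everywhere a
regular subsolution is differentiable, and is bounded below to second order by a positive
semidefinite Hessian of phase almost `Θ`. -/
lemma exists_specForm_le_meanTranslate {Θ : ℝ} (hv : LipschitzWith L v)
    (hconv : ConvexOn ℝ (ball 0 1) v) (hP : ∀ᵐ z ∂P, z ∈ ball 0 ε)
    {a : EuclideanSpace ℝ (Fin n)} (ha : ‖a‖ + ε < 1)
    (hreg : ∀ᵐ z ∂P, IsRegularSubsolutionAt Θ v (a + z)) {τ : ℝ} (hτ : 0 < τ) :
    ∃ (φ : EuclideanSpace ℝ (Fin n) →L[ℝ] ℝ)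
      (b : OrthonormalBasis (Fin n) ℝ (EuclideanSpace ℝ (Fin n))) (w : Fin n → ℝ),
      HasFDerivAt (meanTranslate P v) φ a ∧ (∀ i, 0 ≤ w i) ∧ Θ - τ ≤ ∑ i, Real.arctan (w i) ∧
      ∀ η > 0, ∀ᶠ h in 𝓝 (0 : EuclideanSpace ℝ (Fin n)),
        meanTranslate P v a + φ h + 1 / 2 * specForm b w h - η * ‖h‖ ^ 2 ≤
          meanTranslate P v (a + h) := by
  obtain ⟨W, hmeas, hpos, hW, hexp⟩ := exists_aemeasurable_hessian hv.continuous hreg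
  obtain ⟨K, hK, hKΘ⟩ := exists_le_lagrangianPhase_meanTrunc hmeas hpos hW
    (hexp.mono fun z hz => hz.1) hτ
  set F' : EuclideanSpace ℝ (Fin n) → EuclideanSpace ℝ (Fin n) →L[ℝ] ℝ :=
    fun z => fderiv ℝ v (a + z) with hF'
  have hF'meas : AEStronglyMeasurable F' P :=
    ((measurable_fderiv ℝ v).comp (measurable_const_add a)).aestronglyMeasurable
  have hdiff : ∀ᵐ z ∂P, HasFDerivAt v (F' z) (a + z) := by
    filter_upwards [hexp] with z hz
    obtain ⟨p, hp⟩ := hz.2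
    exact hp.hasFDerivAt.differentiableAt.hasFDerivAt
  obtain ⟨hF'int, hderiv⟩ := hasFDerivAt_integral_of_dominated_loc_of_lip (μ := P)
    (F := fun x z => v (x + z)) (F' := F') (x₀ := a) (s := univ) (bound := fun _ => (L : ℝ))
    univ_mem (Eventually.of_forall fun x => (integrable_translate hv hP x).aestronglyMeasurable)
    (integrable_translate hv hP a) hF'meas
    (Eventually.of_forall fun z => by
      have : LipschitzWith L fun x => v (x + z) := by
        simpa [Function.comp_def] using hv.comp (LipschitzWith.id.add (LipschitzWith.const z))
      simpa using this) (integrable_const _)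
    (by filter_upwards [hdiff] with z hz using (hasFDerivAt_comp_add_right z).2 hz)
  set M := meanTrunc P W K with hM
  have hMh : M.IsHermitian := meanTrunc_isHermitian hW K
  have hMform : ∀ x, quadForm M x = specForm hMh.eigenvectorBasis hMh.eigenvalues x :=
    quadForm_eq_specForm hMh
  refine ⟨∫ z, F' z ∂P, hMh.eigenvectorBasis, hMh.eigenvalues, hderiv, fun i => ?_, hKΘ,
    fun η hη => ?_⟩
  · rw [← specForm_basis hMh.eigenvectorBasis hMh.eigenvalues i, ← hMform,
      ← integral_quadForm_truncMatrix hmeas hK]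
    exact integral_nonneg fun z => quadForm_truncMatrix_nonneg K (hpos z) _
  -- The remainder against the truncated Hessian: it exceeds the true second order remainder because
  -- truncation lowers the form.
  set D : EuclideanSpace ℝ (Fin n) → EuclideanSpace ℝ (Fin n) → ℝ := fun h z =>
    v (a + h + z) - v (a + z) - F' z h - 1 / 2 * quadForm (truncMatrix K (W z)) h with hD
  have hDint : ∀ h, Integrable (D h) P := fun h =>
    (((integrable_translate hv hP (a + h)).sub (integrable_translate hv hP a)).sub
      (hF'int.apply_continuousLinearMap h)).sub
      ((integrable_quadForm_truncMatrix hmeas hK h).const_mul _)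
  have hDval : ∀ h, ∫ z, D h z ∂P = meanTranslate P v (a + h) - meanTranslate P v a -
      (∫ z, F' z ∂P) h - 1 / 2 * specForm hMh.eigenvectorBasis hMh.eigenvalues h := by
    intro h
    rw [← hMform, ← integral_quadForm_truncMatrix hmeas hK, ← integral_const_mul,
      ContinuousLinearMap.integral_apply hF'int h]
    simp only [hD]
    have i1 : Integrable (fun z => v (a + h + z) - v (a + z)) P :=
      (integrable_translate hv hP (a + h)).sub (integrable_translate hv hP a)
    have i2 : Integrable (fun z => v (a + h + z) - v (a + z) - F' z h) P :=
      i1.sub (hF'int.apply_continuousLinearMap h)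
    rw [integral_sub i2 ((integrable_quadForm_truncMatrix hmeas hK h).const_mul _),
      integral_sub i1 (hF'int.apply_continuousLinearMap h),
      integral_sub (integrable_translate hv hP (a + h)) (integrable_translate hv hP a)]
    rfl
  -- Only the negative part of the quotient is needed. Convexity bounds it below by -C uniformly in
  -- h, so dominated convergence applies although the quotient has no such bound from above.
  set m : EuclideanSpace ℝ (Fin n) → EuclideanSpace ℝ (Fin n) → ℝ := fun h z =>
    min (D h z / ‖h‖ ^ 2) 0 with hm
  set C : ℝ := 1 / 2 * (n * (n * K)) with hC
  have hC0 : 0 ≤ C := by positivity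
  have hsmall : ∀ᶠ h in 𝓝 (0 : EuclideanSpace ℝ (Fin n)), ‖h‖ < 1 - (‖a‖ + ε) := by
    filter_upwards [ball_mem_nhds (0 : EuclideanSpace ℝ (Fin n))
      (by linarith : 0 < 1 - (‖a‖ + ε))] with h hh using mem_ball_zero_iff.1 hh
  have hlim : Tendsto (fun h => ∫ z, m h z ∂P) (𝓝 0) (𝓝 (∫ _, (0 : ℝ) ∂P)) := by
    refine tendsto_integral_filter_of_dominated_convergence (fun _ => C) ?_ ?_
      (integrable_const _) ?_
    · refine Eventually.of_forall fun h => ?_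
      exact (((hDint h).div_const _).inf (integrable_const 0)).aestronglyMeasurable
    · filter_upwards [hsmall] with h hh
      filter_upwards [hP, hdiff] with z hz hdz
      have hz' := mem_ball_zero_iff.1 hz
      have h1 : a + z ∈ ball (0 : EuclideanSpace ℝ (Fin n)) 1 := by
        rw [mem_ball_zero_iff]
        linarith [norm_add_le a z, norm_nonneg h]
      have h2 : a + h + z ∈ ball (0 : EuclideanSpace ℝ (Fin n)) 1 := by
        rw [mem_ball_zero_iff]
        linarith [norm_add₃_le (a := a) (b := h) (c := z)]
      have h3 := le_of_convexOn_of_hasFDerivAt isOpen_ball hconv h1 hdz h2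
      have h4 : a + h + z - (a + z) = h := by abel
      rw [h4] at h3
      have h5 := (abs_le.1 (abs_quadForm_le (abs_truncMatrix_le hK (W z)) h)).2
      have h6 : -(C * ‖h‖ ^ 2) ≤ D h z := by
        simp only [hD, hC]
        linarith
      have h7 : -C ≤ D h z / ‖h‖ ^ 2 := by
        rcases (sq_nonneg ‖h‖).eq_or_lt with h0 | h0
        · rw [← h0, div_zero]; linarith
        · rw [le_div_iff₀ h0]; linarith
      rw [Real.norm_eq_abs, abs_le]
      exact ⟨le_min h7 (by linarith), (min_le_right _ _).trans hC0⟩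
    · filter_upwards [hexp] with z hz
      obtain ⟨p, hp⟩ := hz.2
      rw [Metric.tendsto_nhds]
      intro δ hδ
      filter_upwards [hp (δ / 2) (half_pos hδ)] with h hh
      have h1 := (abs_le.1 hh).1
      have h2 : F' z = innerSL ℝ p := hp.hasFDerivAt.fderiv
      have h3 := quadForm_truncMatrix_le K (hpos z) h
      have h4 : -(δ / 2 * ‖h‖ ^ 2) ≤ D h z := by
        simp only [hD, h2, innerSL_apply_apply]
        rw [add_right_comm a z h] at h1
        linarith
      have h5 : -(δ / 2) ≤ D h z / ‖h‖ ^ 2 := by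
        rcases (sq_nonneg ‖h‖).eq_or_lt with h0 | h0
        · rw [← h0, div_zero]; linarith
        · rw [le_div_iff₀ h0]; linarith
      rw [Real.dist_eq, sub_zero, abs_lt]
      exact ⟨lt_of_lt_of_le (by linarith) (le_min h5 (by linarith)),
        (min_le_right _ _).trans_lt hδ⟩
  rw [integral_zero] at hlim
  filter_upwards [hlim.eventually (lt_mem_nhds (by linarith : -η < 0))] with h hh
  have h1 : ∫ z, m h z ∂P ≤ (∫ z, D h z ∂P) / ‖h‖ ^ 2 := by
    rw [← integral_div]
    exact integral_mono (((hDint h).div_const _).inf (integrable_const 0))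
      ((hDint h).div_const _) fun z => min_le_left _ _
  rw [hDval] at h1
  rcases (sq_nonneg ‖h‖).eq_or_lt with h0 | h0
  · have : h = 0 := by simpa using h0.symm
    subst this
    simp [specForm]
  · have h2 := hh.trans_le h1
    rw [lt_div_iff₀ h0] at h2
    linarith

end

end MeanValue

/-! ### The rotation identity and stability of contact under duality. -/

section Contact

open Set Metric Filter Topology MeasureTheory
open scoped NNReal

variable {n : ℕ}

/-- The addition formula with α = arctan(tan α): the product of the two tangents is 1 - 1/(cν) < 1,
so no multiple of π appears. -/
lemma arctan_rotation {α ν : ℝ} (hα₀ : 0 < α) (hα₁ : α < Real.pi / 2) (hν : 0 < ν) :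
    Real.arctan ((Real.sin α)⁻¹ * (ν - Real.cos α)) =
      Real.arctan ((Real.sin α)⁻¹ * (Real.cos α - ν⁻¹)) + α := by
  have hs : 0 < Real.sin α := Real.sin_pos_of_pos_of_lt_pi hα₀ (by linarith [Real.pi_pos])
  have hc : 0 < Real.cos α := Real.cos_pos_of_mem_Ioo ⟨by linarith, hα₁⟩
  have hα : Real.arctan (Real.tan α) = α := Real.arctan_tan (by linarith) hα₁
  have hprod : (Real.sin α)⁻¹ * (Real.cos α - ν⁻¹) * Real.tan α =
      1 - (Real.cos α * ν)⁻¹ := by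
    rw [Real.tan_eq_sin_div_cos]
    field_simp
  have hpos : 0 < (Real.cos α * ν)⁻¹ := by positivity
  have hadd := Real.arctan_add (x := (Real.sin α)⁻¹ * (Real.cos α - ν⁻¹)) (y := Real.tan α)
    (by rw [hprod]; linarith)
  rw [hα, hprod] at hadd
  rw [hadd]
  congr 1
  rw [Real.tan_eq_sin_div_cos]
  have h1 := Real.sin_sq_add_cos_sq α
  have h2 : 1 - (1 - (Real.cos α * ν)⁻¹) = (Real.cos α * ν)⁻¹ := by ring
  rw [h2]
  field_simp
  linear_combination (-ν) * h1

/-- Stability of a strict contact of the Legendre transform with a function from below, under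
uniform perturbations of the potential. -/
lemma exists_contact {f g R : EuclideanSpace ℝ (Fin n) → ℝ} {c ρ r σ δ : ℝ} (hc : 0 < c)
    (hρ : 0 < ρ) (hr : 0 < r) (hσ : 0 < σ) (hf : StrongConvexOn (ball 0 1.2) c f)
    (hfc : ContinuousOn f (ball 0 1.2)) {a₀ y₀ : EuclideanSpace ℝ (Fin n)}
    (ha₀ : closedBall a₀ ρ ⊆ ball 0 1) (hy₀ : y₀ ∈ subdifferential (ball 0 1.2) f a₀)
    (hR : ContinuousOn R (closedBall y₀ r)) (hR₀ : R y₀ = legendre f y₀)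
    (hRle : ∀ y ∈ closedBall y₀ r, R y + σ * ‖y - y₀‖ ^ 2 ≤ legendre f y)
    (hrρ : r ≤ c * ρ / 8) (hg : ContinuousOn g (closedBall a₀ ρ))
    (hgf : ∀ x ∈ closedBall a₀ ρ, |g x - f x| ≤ δ) (hδ₁ : δ ≤ σ * r ^ 2 / 4)
    (hδ₂ : δ ≤ c * ρ ^ 2 / 16) :
    ∃ y₁ ∈ ball y₀ r, ∃ a₁ ∈ ball a₀ ρ,
      (∀ x ∈ closedBall a₀ ρ, inner ℝ y₁ x - g x ≤ inner ℝ y₁ a₁ - g a₁) ∧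
      ∀ y ∈ closedBall y₀ r, conjOn (closedBall a₀ ρ) g y₁ - R y₁ ≤
        conjOn (closedBall a₀ ρ) g y - R y := by
  set X := closedBall a₀ ρ with hX
  have ha₀X : a₀ ∈ X := mem_closedBall_self hρ.le
  have hX1 : X ⊆ closedBall 0 1 := ha₀.trans ball_subset_closedBall
  have hXc : IsCompact X := isCompact_closedBall _ _
  have hgb : BddBelow (g '' X) := hXc.bddBelow_image hg
  have hΦ : Continuous (conjOn X g) := (lipschitzWith_conjOn hX1 hgb ⟨a₀, ha₀X⟩).continuous
  obtain ⟨y₁, hy₁, hmin⟩ := (isCompact_closedBall y₀ r).exists_isMinOn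
    (nonempty_closedBall.2 hr.le) (hΦ.continuousOn.sub hR)
  have hmin' : ∀ y ∈ closedBall y₀ r, conjOn X g y₁ - R y₁ ≤ conjOn X g y - R y := hmin
  obtain ⟨a₁, ha₁, hmax⟩ := hXc.exists_isMaxOn ⟨a₀, ha₀X⟩
    ((Continuous.continuousOn (by fun_prop : Continuous fun x => inner ℝ y₁ x)).sub hg)
  have hmax' : ∀ x ∈ X, inner ℝ y₁ x - g x ≤ inner ℝ y₁ a₁ - g a₁ := hmax
  have hy₁r : ‖y₁ - y₀‖ ≤ r := mem_closedBall_iff_norm.1 hy₁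
  refine ⟨y₁, ?_, a₁, ?_, hmax', hmin'⟩
  -- The two conjugates differ by at most δ at `y₀` and `y₁`, so `σ * ‖y₁ - y₀‖ ^ 2 ≤ 2 * δ` and the
  -- minimum is interior.
  · have h1 : conjOn X g y₀ ≤ legendre f y₀ + δ := by
      refine conjOn_le ⟨a₀, ha₀X⟩ fun x hx => ?_
      have h2 := le_legendre hfc (ha₀ hx) y₀
      have h3 := (abs_le.1 (hgf x hx)).1
      linarith
    have h2 : legendre f y₁ - δ ≤ conjOn X g y₁ := by
      obtain ⟨x, hx, hxy⟩ := hf.exists_mem_subdifferential hc hfc hρ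
        (ha₀.trans unitBall_subset) hy₀ (y := y₁) (by nlinarith)
      have hxX : x ∈ X := ball_subset_closedBall hx
      rw [legendre_eq_of_mem hfc (ha₀ hxX) hxy]
      have h3 := le_conjOn hX1 hgb hxX y₁
      have h4 := (abs_le.1 (hgf x hxX)).2
      linarith
    have h3 := hmin' y₀ (mem_closedBall_self hr.le)
    have h4 := hRle y₁ hy₁
    have h5 : σ * ‖y₁ - y₀‖ ^ 2 ≤ σ * (r ^ 2 / 2) := by linarith
    have h6 := le_of_mul_le_mul_left h5 hσ
    rw [mem_ball_iff_norm]
    refine lt_of_pow_lt_pow_left₀ 2 hr.le ?_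
    have : 0 < r ^ 2 := by positivity
    linarith
  -- Maximality and strong convexity give `c / 2 * ‖a₁ - a₀‖ ^ 2 ≤ 2 * δ + ‖y₁ - y₀‖ * ‖a₁ - a₀‖`,
  -- at most `c * ρ ^ 2 / 4`.
  · have h1 := hmax' a₀ ha₀X
    have h2 := (abs_le.1 (hgf a₁ ha₁)).1
    have h3 := (abs_le.1 (hgf a₀ ha₀X)).2
    have h4 := hf.le_of_mem_subdifferential (unitBall_subset (ha₀ ha₀X)) hy₀
      (unitBall_subset (ha₀ ha₁))
    have h5 : inner ℝ (y₁ - y₀) (a₁ - a₀) ≤ ‖y₁ - y₀‖ * ‖a₁ - a₀‖ := real_inner_le_norm _ _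
    have h6 : ‖y₁ - y₀‖ * ‖a₁ - a₀‖ ≤ c * ρ / 8 * ρ := by
      have : ‖a₁ - a₀‖ ≤ ρ := mem_closedBall_iff_norm.1 ha₁
      gcongr
      exact hy₁r.trans hrρ
    rw [inner_sub_left, inner_sub_right y₁] at h5
    have h7 : c * ‖a₁ - a₀‖ ^ 2 ≤ c * (ρ ^ 2 / 2) := by
      nlinarith
    have h8 := le_of_mul_le_mul_left h7 hc
    rw [mem_ball_iff_norm]
    refine lt_of_pow_lt_pow_left₀ 2 hρ.le ?_
    have : 0 < ρ ^ 2 := by positivity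
    linarith

/-- At a contact point, a lower second order bound on the potential gives an upper second order
bound on the function that touches the conjugate from below. -/
lemma eventually_sub_le_of_contact {g R : EuclideanSpace ℝ (Fin n) → ℝ}
    {X : Set (EuclideanSpace ℝ (Fin n))} {y₀ y₁ a₁ : EuclideanSpace ℝ (Fin n)} {r κ : ℝ}
    (hX : X ⊆ closedBall 0 1) (hgb : BddBelow (g '' X)) (hg : ConvexOn ℝ X g) (ha₁ : a₁ ∈ X)
    (hy₁ : y₁ ∈ ball y₀ r)
    (hmin : ∀ y ∈ closedBall y₀ r, conjOn X g y₁ - R y₁ ≤ conjOn X g y - R y)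
    (b : OrthonormalBasis (Fin n) ℝ (EuclideanSpace ℝ (Fin n))) {ν : Fin n → ℝ} (hκ : 0 < κ)
    (hν : ∀ i, κ ≤ ν i)
    (hlow : ∀ᶠ h in 𝓝 (0 : EuclideanSpace ℝ (Fin n)),
      g a₁ + inner ℝ y₁ h + 1 / 2 * specForm b ν h ≤ g (a₁ + h)) :
    ∀ᶠ k in 𝓝 (0 : EuclideanSpace ℝ (Fin n)),
      R (y₁ + k) - R y₁ ≤ inner ℝ k a₁ + 1 / 2 * specForm b (fun i => (ν i)⁻¹) k := by
  obtain ⟨t, ht, htb⟩ := nhds_basis_closedBall.eventually_iff.1 hlow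
  have h1 : ∀ᶠ k in 𝓝 (0 : EuclideanSpace ℝ (Fin n)), k ∈ closedBall 0 (κ * t / 2) :=
    closedBall_mem_nhds _ (by positivity)
  have h2 : ∀ᶠ k in 𝓝 (0 : EuclideanSpace ℝ (Fin n)), y₁ + k ∈ ball y₀ r := by
    have : Continuous fun k => y₁ + k := by fun_prop
    exact (this.tendsto' 0 y₁ (by simp)).eventually_mem (isOpen_ball.mem_nhds hy₁)
  filter_upwards [h1, h2] with k hk hk2
  have h3 : conjOn X g (y₁ + k) ≤ inner ℝ y₁ a₁ - g a₁ + inner ℝ k a₁ +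
      1 / 2 * specForm b (fun i => (ν i)⁻¹) k :=
    conjOn_le ⟨a₁, ha₁⟩ fun x hx => inner_sub_le_of_specForm_le hg ha₁ b hκ hν ht
      (fun h hh _ => htb (mem_closedBall_zero_iff.2 hh)) (mem_closedBall_zero_iff.1 hk) hx
  have h4 := le_conjOn hX hgb ha₁ y₁
  have h5 := hmin _ (ball_subset_closedBall hk2)
  linarith

lemma forall_le_of_eventually_le {q₁ q₂ : EuclideanSpace ℝ (Fin n) → ℝ}
    (h₁ : ∀ (t : ℝ) x, q₁ (t • x) = t ^ 2 * q₁ x) (h₂ : ∀ (t : ℝ) x, q₂ (t • x) = t ^ 2 * q₂ x)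
    (h : ∀ᶠ k in 𝓝 (0 : EuclideanSpace ℝ (Fin n)), q₁ k ≤ q₂ k)
    (x : EuclideanSpace ℝ (Fin n)) : q₁ x ≤ q₂ x := by
  have hlim : Tendsto (fun t : ℝ => t • x) (𝓝[>] 0) (𝓝 0) := by
    have : Continuous fun t : ℝ => t • x := by fun_prop
    exact (this.tendsto' 0 0 (by simp)).mono_left nhdsWithin_le_nhds
  obtain ⟨t, ht, ht0⟩ := ((hlim.eventually h).and self_mem_nhdsWithin).exists
  rw [h₁, h₂] at ht
  have ht0' : (0 : ℝ) < t := ht0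
  exact le_of_mul_le_mul_left ht (by positivity)

lemma IsRegularSubsolutionAt.congr {Θ : ℝ} {u v : EuclideanSpace ℝ (Fin n) → ℝ}
    {x : EuclideanSpace ℝ (Fin n)} (hu : IsRegularSubsolutionAt Θ u x) (h : u =ᶠ[𝓝 x] v) :
    IsRegularSubsolutionAt Θ v x := by
  obtain ⟨p, W, hW, h1, h2, h3⟩ := hu
  refine ⟨p, W, hW, h1, h2, fun η hη => ?_⟩
  have hshift : Tendsto (fun k => x + k) (𝓝 0) (𝓝 x) := by
    have : Continuous fun k => x + k := by fun_prop
    exact this.tendsto' 0 x (by simp)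
  filter_upwards [h3 η hη, hshift.eventually h] with k hk hk'
  rwa [← hk', ← h.eq_of_nhds]

/-- A globally Lipschitz extension makes every translate integrable, with no domain to track when
averaging. -/
lemma exists_lipschitzWith_eqOn {u : EuclideanSpace ℝ (Fin n) → ℝ}
    (hu : ConvexOn ℝ (ball 0 1.2) u) :
    ∃ (L : ℝ≥0) (v : EuclideanSpace ℝ (Fin n) → ℝ), LipschitzWith L v ∧ EqOn u v (ball 0 1) := by
  obtain ⟨M, hM⟩ := exists_abs_le (hu.continuousOn isOpen_ball)
  have hsub : ball (0 : EuclideanSpace ℝ (Fin n)) 1.1 ⊆ ball 0 1.2 :=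
    ball_subset_ball (by norm_num)
  obtain ⟨L, hL⟩ := (hu.subset hsub (convex_ball _ _)).exists_lipschitzOnWith_of_isBounded
    (r' := 1) (by norm_num) (by
      rw [isBounded_iff_forall_norm_le]
      refine ⟨M, ?_⟩
      rintro _ ⟨x, hx, rfl⟩
      exact hM x (ball_subset_closedBall hx))
  obtain ⟨v, hv, huv⟩ := hL.extend_real
  exact ⟨L, v, hv, huv⟩

end Contact

/-! ### The viscosity inequality for the rotation. -/

section Main

open Set Metric Filter Topology MeasureTheory
open scoped NNReal

variable {n : ℕ}

/-- The touching property, up to an error that is proportional to `t`. -/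
lemma le_lagrangianPhase_add_of_touching {Θ α : ℝ} (hα₀ : 0 < α) (hα₁ : α < Real.pi / 2)
    {u : EuclideanSpace ℝ (Fin n) → ℝ} (hconv : ConvexOn ℝ (ball 0 1.2) u)
    (hsub : IsViscositySubsolution Θ (ball 0 1.2) u) {y₀ : EuclideanSpace ℝ (Fin n)}
    (hy₀ : y₀ ∈ dualDomain (tildePotential α u)) {A : Matrix (Fin n) (Fin n) ℝ}
    (hA : A.IsHermitian) {p : EuclideanSpace ℝ (Fin n)} {β : ℝ}
    (heq : quadraticFn A p β y₀ = alphaRotation α u y₀)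
    (hle : ∀ᶠ y in 𝓝 y₀, alphaRotation α u y ≤ quadraticFn A p β y) {t : ℝ} (ht : 0 < t) :
    Θ - n * α ≤ lagrangianPhase hA + (3 * n + 1) * t := by
  set s := Real.sin α with hs_def
  set c := Real.cos α with hc_def
  have hs : 0 < s := Real.sin_pos_of_pos_of_lt_pi hα₀ (by linarith [Real.pi_pos])
  have hc : 0 < c := Real.cos_pos_of_mem_Ioo ⟨by linarith, hα₁⟩
  set f := tildePotential α u with hf_def
  have hf : StrongConvexOn (ball 0 1.2) c f := strongConvexOn_tildePotential hs hconv
  have hfc : ContinuousOn f (ball 0 1.2) := continuousOn_tildePotential hsub.1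
  obtain ⟨a₀, ha₀, hya⟩ := mem_dualDomain.1 hy₀
  have ha₀1 : ‖a₀‖ < 1 := mem_ball_zero_iff.1 ha₀
  -- Points of the ρ-ball about `a₀`, translated by a further ρ, stay in the unit ball.
  set ρ := (1 - ‖a₀‖) / 4 with hρ_def
  have hρ : 0 < ρ := by rw [hρ_def]; linarith
  have hXnorm : ∀ x ∈ closedBall a₀ ρ, ‖x‖ + ρ < 1 := fun x hx => by
    have h1 := mem_closedBall_iff_norm.1 hx
    have h2 := norm_le_norm_add_norm_sub' x a₀
    linarith
  have hX : closedBall a₀ ρ ⊆ ball 0 1 := fun x hx => by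
    rw [mem_ball_zero_iff]
    linarith [hXnorm x hx]
  -- the function which touches the Legendre transform from below
  set R : EuclideanSpace ℝ (Fin n) → ℝ := fun y =>
    c / 2 * ‖y‖ ^ 2 - s * quadraticFn A p β y - s * t / 2 * ‖y - y₀‖ ^ 2 with hR
  have hquad : ∀ y h, quadraticFn A p β (y + h) = quadraticFn A p β y +
      inner ℝ (p + WithLp.toLp 2 (A.mulVec y.ofLp)) h + 1 / 2 * quadForm A h :=
    quadraticFn_add hA p β
  have hRc : Continuous R := by
    have : Continuous (quadraticFn A p β) := by
      unfold quadraticFn dotProduct Matrix.mulVec dotProduct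
      fun_prop
    rw [hR]
    fun_prop
  have hrot : ∀ y, s * alphaRotation α u y = c / 2 * ‖y‖ ^ 2 - legendre f y := fun y => by
    simp only [alphaRotation, ← hs_def, ← hc_def, ← hf_def]
    field_simp
  have hR₀ : R y₀ = legendre f y₀ := by
    have := hrot y₀
    rw [← heq] at this
    simp only [hR, sub_self, norm_zero]
    linarith
  obtain ⟨r₀, hr₀, hr₀le⟩ := nhds_basis_closedBall.eventually_iff.1 hle
  set r := min r₀ (c * ρ / 8) with hr_def
  have hr : 0 < r := lt_min hr₀ (by positivity)
  have hRle : ∀ y ∈ closedBall y₀ r, R y + s * t / 2 * ‖y - y₀‖ ^ 2 ≤ legendre f y := by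
    intro y hy
    have h1 := hr₀le (closedBall_subset_closedBall (min_le_left _ _) hy)
    have h2 := mul_le_mul_of_nonneg_left h1 hs.le
    rw [hrot] at h2
    simp only [hR]
    linarith
  -- the perturbed potential
  obtain ⟨L, v, hv, huv⟩ := exists_lipschitzWith_eqOn hconv
  have hvconv : ConvexOn ℝ (ball 0 1) v :=
    (hconv.subset unitBall_subset (convex_ball _ _)).congr huv
  set δ := min (s * t / 2 * r ^ 2 / 4) (c * ρ ^ 2 / 16) with hδ_def
  have hδ : 0 < δ := lt_min (by positivity) (by positivity)
  -- Averaging at scale ε moves an L-Lipschitz function by at most Lε, hence f by at most δ; `L + 1`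
  -- avoids dividing by 0.
  set ε := min (ρ / 2) (δ / (s * (L + 1))) with hε_def
  have hε : 0 < ε := lt_min (by positivity) (by positivity)
  have hερ : ε < ρ := (min_le_left _ _).trans_lt (by linarith)
  have hLε : s * (L * ε) ≤ δ := by
    have h1 : ε ≤ δ / (s * (L + 1)) := min_le_right _ _
    rw [le_div_iff₀ (by positivity)] at h1
    nlinarith [mul_pos hs hε]
  set P : Measure (EuclideanSpace ℝ (Fin n)) :=
    ProbabilityTheory.cond volume (ball 0 ε) with hP_def
  have : IsProbabilityMeasure P :=
    ProbabilityTheory.cond_isProbabilityMeasure_of_finite (measure_ball_pos _ _ hε).ne'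
      measure_ball_lt_top.ne
  have hP : ∀ᵐ z ∂P, z ∈ ball 0 ε := ProbabilityTheory.ae_cond_mem measurableSet_ball
  set V := meanTranslate P v with hV
  set g : EuclideanSpace ℝ (Fin n) → ℝ := fun x => s * V x + c / 2 * ‖x‖ ^ 2 with hg
  have hVc : Continuous V := continuous_meanTranslate hv hP
  have hgc : Continuous g := by rw [hg]; fun_prop
  have hgconv : ConvexOn ℝ (closedBall a₀ ρ) g := by
    have h1 : ConvexOn ℝ (closedBall a₀ ρ) V :=
      convexOn_meanTranslate hv hP hvconv (convex_closedBall _ _) fun x hx z hz => by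
        rw [mem_ball_zero_iff] at hz ⊢
        linarith [norm_add_le x z, hXnorm x hx]
    have h2 : StrongConvexOn (closedBall a₀ ρ) c g := by
      rw [strongConvexOn_iff_convex]
      refine (h1.smul hs.le).congr fun x _ => ?_
      simp [hg]
    exact (h2.strictConvexOn hc).convexOn
  have hgf : ∀ x ∈ closedBall a₀ ρ, |g x - f x| ≤ δ := by
    intro x hx
    have h1 := abs_meanTranslate_sub_le hv hP x
    have h2 : g x - f x = s * (V x - v x) := by
      rw [← huv (hX hx)]
      simp only [hg, hf_def, tildePotential]
      ring
    rw [h2, abs_mul, abs_of_pos hs]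
    exact (mul_le_mul_of_nonneg_left h1 hs.le).trans hLε
  obtain ⟨y₁, hy₁, a₁, ha₁, hmax, hmin⟩ := exists_contact hc hρ hr (by positivity) hf hfc hX hya
    hRc.continuousOn hR₀ hRle (min_le_right _ _) hgc.continuousOn hgf (min_le_left _ _)
    (min_le_right _ _)
  have ha₁X : a₁ ∈ closedBall a₀ ρ := ball_subset_closedBall ha₁
  -- the second order behaviour of the perturbed potential at the contact point
  have hreg : ∀ᵐ z ∂P, IsRegularSubsolutionAt Θ v (a₁ + z) := by
    have h1 : ∀ᵐ x : EuclideanSpace ℝ (Fin n), x ∈ ball 0 1 → IsRegularSubsolutionAt Θ v x := by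
      filter_upwards [ae_isRegularSubsolutionAt hs hc hconv hsub] with x hx hx1
      exact (hx hx1).congr (huv.eventuallyEq_of_mem (isOpen_ball.mem_nhds hx1))
    have h2 : ∀ᵐ z : EuclideanSpace ℝ (Fin n),
        a₁ + z ∈ ball 0 1 → IsRegularSubsolutionAt Θ v (a₁ + z) :=
      (measurePreserving_add_left volume a₁).quasiMeasurePreserving.ae h1
    have h3 := (ProbabilityTheory.cond_absolutelyContinuous (μ := volume)
      (s := ball (0 : EuclideanSpace ℝ (Fin n)) ε)).ae_le h2
    filter_upwards [h3, hP] with z hz hzε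
    refine hz ?_
    rw [mem_ball_zero_iff] at hzε ⊢
    linarith [norm_add_le a₁ z, hXnorm a₁ ha₁X]
  obtain ⟨φ, b, w, hφ, hw, hwΘ, hlow⟩ := exists_specForm_le_meanTranslate hv hvconv hP
    (a := a₁) (by linarith [hXnorm a₁ ha₁X]) hreg ht
  -- The second bound keeps every `ν i` at least c/2, so that it can be inverted.
  set η := min t (c / (4 * s)) with hη_def
  have hη : 0 < η := lt_min ht (by positivity)
  have hηt : η ≤ t := min_le_left _ _
  have hηc : 2 * s * η ≤ c / 2 := by
    have h1 : η ≤ c / (4 * s) := min_le_right _ _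
    rw [le_div_iff₀ (by positivity)] at h1
    linarith
  have hg' : HasFDerivAt g (s • φ + c • innerSL ℝ a₁) a₁ := by
    have h1 : HasFDerivAt (fun x : EuclideanSpace ℝ (Fin n) => c / 2 * ‖x‖ ^ 2)
        (c • innerSL ℝ a₁) a₁ := by
      refine ((hasStrictFDerivAt_norm_sq a₁).hasFDerivAt.const_mul (c / 2)).congr_fderiv ?_
      ext h
      simp
      ring
    exact (hφ.const_mul s).add h1
  -- `a₁` maximizes y₁·x - g(x) and is interior, so differentiability forces the gradient of g there
  -- to be `y₁`.
  have hgrad : s • φ + c • innerSL ℝ a₁ = innerSL ℝ y₁ :=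
    eq_innerSL_of_subgradient hg' (by
      filter_upwards [isOpen_ball.mem_nhds ha₁] with x hx
      have := hmax x (ball_subset_closedBall hx)
      rw [inner_sub_right]
      linarith)
  set ν : Fin n → ℝ := fun i => s * w i + (c + -(2 * s * η)) with hν_def
  have hν : ∀ i, c / 2 ≤ ν i := fun i => by
    have := mul_nonneg hs.le (hw i)
    simp only [hν_def]
    linarith
  have hglow : ∀ᶠ h in 𝓝 (0 : EuclideanSpace ℝ (Fin n)),
      g a₁ + inner ℝ y₁ h + 1 / 2 * specForm b ν h ≤ g (a₁ + h) := by
    filter_upwards [hlow η hη] with h hh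
    have h1 : s * φ h + c * inner ℝ a₁ h = inner ℝ y₁ h := by
      have := DFunLike.congr_fun hgrad h
      simpa using this
    have h2 := mul_le_mul_of_nonneg_left hh hs.le
    rw [hν_def, specForm_add, specForm_const_mul, specForm_const, ← h1]
    simp only [hg]
    rw [norm_add_sq_real]
    linarith
  have hX1 : closedBall a₀ ρ ⊆ closedBall 0 1 := hX.trans ball_subset_closedBall
  have hRup := eventually_sub_le_of_contact hX1
    ((isCompact_closedBall a₀ ρ).bddBelow_image hgc.continuousOn) hgconv ha₁X hy₁ hmin b
    (half_pos hc) hν hglow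
  -- comparison of the Hessians
  have hHess : ∀ x, specForm b (fun i => s⁻¹ * (c + -(ν i)⁻¹)) x ≤
      specForm hA.eigenvectorBasis (fun i => hA.eigenvalues i + t) x := by
    refine forall_le_of_eventually_le (fun τ x => specForm_smul b _ τ x)
      (fun τ x => specForm_smul _ _ τ x) ?_
    -- Adding the bounds at k and -k cancels all first order terms and leaves cI - sA - stI ≤
    -- diag(1/ν), with the diagonal taken in the basis b.
    have hneg : Tendsto (fun k : EuclideanSpace ℝ (Fin n) => -k) (𝓝 0) (𝓝 0) :=
      continuous_neg.tendsto' 0 0 neg_zero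
    filter_upwards [hRup, hneg.eventually hRup] with k h1 h2
    have h3 : specForm b (fun i => (ν i)⁻¹) (-k) = specForm b (fun i => (ν i)⁻¹) k := by
      rw [← neg_one_smul ℝ k, specForm_smul]; ring
    have h4 : quadForm A (-k) = quadForm A k := by
      rw [← neg_one_smul ℝ k, quadForm_smul]; ring
    have h5 : y₁ + k - y₀ = (y₁ - y₀) + k := by abel
    have h6 : y₁ + -k - y₀ = (y₁ - y₀) + -k := by abel
    rw [h3] at h2
    simp only [hR, h5, h6, hquad, norm_add_sq_real, inner_neg_right, inner_neg_left, norm_neg,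
      h4] at h1 h2
    have h7 : specForm b (fun i => -(ν i)⁻¹) k = -specForm b (fun i => (ν i)⁻¹) k := by
      simp [specForm]
    rw [specForm_const_mul, specForm_add, specForm_add, specForm_const, specForm_const, h7,
      ← quadForm_eq_specForm hA, inv_mul_le_iff₀ hs]
    linarith
  have hsum := sum_le_sum_of_specForm_le b hA.eigenvectorBasis hHess Real.arctan_mono
  have h1 : ∑ i, Real.arctan (hA.eigenvalues i + t) ≤ lagrangianPhase hA + n * t := by
    have : ∑ i, Real.arctan (hA.eigenvalues i + t) ≤ ∑ i, (Real.arctan (hA.eigenvalues i) + t) :=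
      Finset.sum_le_sum fun i _ => arctan_add_le _ ht.le
    rw [Finset.sum_add_distrib] at this
    simpa [lagrangianPhase] using this
  have h2 : ∑ i, Real.arctan (w i) - n * α - n * (2 * t) ≤
      ∑ i, Real.arctan (s⁻¹ * (c + -(ν i)⁻¹)) := by
    have : ∑ i, (Real.arctan (w i) - α - 2 * t) ≤
        ∑ i, Real.arctan (s⁻¹ * (c + -(ν i)⁻¹)) := by
      refine Finset.sum_le_sum fun i _ => ?_
      have h3 := arctan_rotation hα₀ hα₁ ((half_pos hc).trans_le (hν i))
      rw [← hs_def, ← hc_def] at h3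
      have h4 : s⁻¹ * (ν i - c) = w i - 2 * η := by
        simp only [hν_def]
        field_simp
        ring
      have h5 := arctan_add_le (w i - 2 * η) (by positivity : 0 ≤ 2 * η)
      rw [sub_add_cancel] at h5
      rw [h4] at h3
      rw [← sub_eq_add_neg]
      linarith
    simpa [Finset.sum_sub_distrib] using this
  -- The errors are t from averaging, `n * t` from the strictness penalty and `2 * n * t` from the
  -- η-loss in ν.
  linarith

theorem proposition2p3 (n : ℕ) (Θ α : ℝ) (hα₀ : 0 < α) (hα₁ : α < Real.pi / 2)
    (u : EuclideanSpace ℝ (Fin n) → ℝ)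
    (hconv : ConvexOn ℝ (Metric.ball 0 1.2) u)
    (hsub : IsViscositySubsolution Θ (Metric.ball 0 1.2) u) :
    IsOpen (rotatedDomain α u) ∧ IsConnected (rotatedDomain α u) ∧
      (∀ y ∈ rotatedDomain α u, BddAbove (legendreValues (tildePotential α u) y)) ∧
      IsViscositySubsolution (Θ - n * α) (rotatedDomain α u) (alphaRotation α u) := by
  have hs : 0 < Real.sin α := Real.sin_pos_of_pos_of_lt_pi hα₀ (by linarith [Real.pi_pos])
  have hc : 0 < Real.cos α := Real.cos_pos_of_mem_Ioo ⟨by linarith, hα₁⟩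
  have hf := strongConvexOn_tildePotential hs hconv
  have hfc : ContinuousOn (tildePotential α u) (ball 0 1.2) := continuousOn_tildePotential hsub.1
  have hopen : IsOpen (rotatedDomain α u) := isOpen_dualDomain hf hc hfc
  refine ⟨hopen, isConnected_dualDomain hf hc hfc, fun y _ => ?_, ?_, ?_⟩
  · exact bddAbove_inner_sub ball_subset_closedBall (bddBelow_image_of_continuousOn hfc) y
  · have h1 : Continuous (legendre (tildePotential α u)) := (lipschitzWith_legendre hfc).continuous
    have h2 : Continuous (alphaRotation α u) := by
      unfold alphaRotation
      fun_prop
    exact h2.continuousOn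
  · intro y₀ hy₀ A hA p β heq hle
    rw [hopen.nhdsWithin_eq hy₀] at hle
    refine le_of_forall_pos_le_add fun ε hε => ?_
    have h1 := le_lagrangianPhase_add_of_touching hα₀ hα₁ hconv hsub hy₀ hA heq hle
      (t := ε / (3 * n + 1)) (by positivity)
    rwa [mul_div_cancel₀ _ (by positivity)] at h1

end Main
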